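/- **Setting.** Let $G$ be a finite group with unit $1$; write $\bar g=g^{-1}$. The quantum double $\mathcal D(G)$ is the unital $*$-algebra with basis $(g,h)\in G\times G$, product $(g_1,h_1)(g_2,h_2)=\delta_{g_1,\,h_1g_2\bar h_1}(g_1,h_1h_2)$, unit $\sum_k (k,1)$ and $(g,h)^*=(\bar hgh,\bar h)$. An $n$-dimensional unitary representation is a unital $*$-homomorphism $D:\mathcal D(G)\to M_n(\mathbb C)$. Let $\Gamma$ be the triangular lattice in $\mathbb R^2$ with all edges oriented to the right. Let $\mathcal A$ be the quasi-local $C^*$-algebra with one copy of $\mathrm{End}(\mathbb C[G])$ for each edge, and $\mathcal A_X\subset\mathcal A$ the norm-closed subalgebra of observables supported on a set $X$ of edges. A subset of $\mathbb R^2$ is identified with the set of edges whose midpoints lie in it. A cone is a set $\{x:(x-a)\cdot\hat v>\|x-a\|\cos(\theta/2)\}$ with $a\in\mathbb R^2$, $\|\hat v\|=1$, $\theta\in(0,2\pi)$, or the same set with $\ge$. A site $s=(v,f)$ is a face $f$ with one of its corners $v$. The dual edge $e^*$ of an edge $e$ crosses $e$ from right to left. A direct triangle $\tau=(s_0,s_1,e)$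 consists of sites $s_0,s_1$ with the same face and the edge $e$ connecting their vertices; a dual triangle $\tau=(s_0,s_1,e)$ consists of sites $s_0,s_1$ with the same vertex and the edge $e$ whose dual edge connects their faces. Put $\partial_i\tau=s_i$ and $\bar\tau=(s_1,s_0,e)$. A direct triangle is positive if its face lies to the right of its edge oriented from $v(s_0)$ to $v(s_1)$; a dual triangle is positive if its vertex lies to the left of its dual edge oriented from $f(s_0)$ to $f(s_1)$; otherwise a triangle is negative. A (finite or half-infinite) ribbon is a (finite or infinite) sequence of triangles $\tau_1,\tau_2,\dots$ with $\partial_1\tau_i=\partial_0\tau_{i+1}$ in which no edge of $\Gamma$ occurs twice; it is positive (negative) if all its triangles are. The opposite of $\rho=\tau_1\cdots\tau_l$ is $\bar\rho=\bar\tau_l\cdots\bar\tau_1$. For half-infinite $\rho$, $\rho_m$ is the ribbon of its first $m$ triangles. On an edge $e$ let $L_e^h=\sum_g|hg\rangle\langle g|$, $R_e^h=\sum_g|g\bar h\rangle\langle g|$, $T_e^g=|g\rangle\langle g|$. For a direct triangle put $F_\tau^{h,g}=T_e^g$ if $e=(v(s_0),v(s_1))$ and $F_\tau^{h,g}=T_e^{\bar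 g}$ if $e=(v(s_1),v(s_0))$. For a dual triangle put $F_\tau^{h,g}=\delta_{g,1}L_\tau^h$, where, if $e^*=(f(s_0),f(s_1))$, $L_\tau^h=L_e^h$ when $v(s_0)$ is the origin of $e$ and $L^h_\tau=R_e^{\bar h}$ when it is the target of $e$; and if $e^*=(f(s_1),f(s_0))$, $L_\tau^h=L_e^{\bar h}$, respectively $R_e^{h}$. The empty ribbon has $F^{h,g}=\delta_{g,1}\mathbf 1$, and $F_{\rho_1\rho_2}^{h,g}=\sum_kF_{\rho_1}^{h,k}F_{\rho_2}^{\bar khk,\bar kg}$. Let $$\mathbf F_\rho^D=\sum_{g,h}F_\rho^{g,h}\otimes D(g,h)\in M_n(\mathcal A),\qquad \mu_\rho^D(O)=\mathbf F_\rho^D\,(O\otimes\mathbf 1_n)\,(\mathbf F_\rho^D)^*\quad(O\in\mathcal A)$$ for finite ribbons $\rho$, and $\mu_\rho^D(O)=\lim_{m\to\infty}\mu_{\rho_m}^D(O)$ (in norm) for half-infinite ribbons. Let $A_v=|G|^{-1}\sum_hF^{h,1}_{\rho}$ with $\rho$ the counterclockwise closed dual ribbon around the vertex $v$, and $B_f=F^{1,1}_{\rho}$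 with $\rho$ the counterclockwise closed direct ribbon around the face $f$. Let $\omega_0$ be the frustration-free ground state, i.e. the state on $\mathcal A$ with $\omega_0(A_v)=\omega_0(B_f)=1$ for all $v,f$; let $(\pi_0,\mathcal H_0,\Omega)$ be its GNS triple and $\mathcal R(\Lambda)=\pi_0(\mathcal A_\Lambda)''$. A bridge from a half-infinite ribbon $\rho$ to a half-infinite ribbon $\rho'$ is a sequence of finite ribbons $\xi_m$ ($m\ge1$) such that each concatenation $\sigma_m=\rho_m\,\xi_m\,\overline{\rho'_m}$ is a finite ribbon, and such that for every ball the $\xi_m$ are eventually supported outside of it; $\{\sigma_m\}$ is its intertwining sequence. **Lemma.** Let $\rho$ be a positive and $\rho'$ a negative half-infinite ribbon, both supported in a cone $\Lambda$, and suppose that there is a bridge from $\rho$ to $\rho'$ whose intertwining sequence $\{\sigma_m\}$ is supported in $\Lambda$. Let $D$ be an $n$-dimensional unitary representation of $\mathcal D(G)$. Then the limits defining $\mu_\rho^D$ and $\mu_{\rho'}^D$ exist, and there is a unitary $U\in M_n(\mathcal R(\Lambda))$ such that $$(\pi_0\otimes\mathrm{id})\circ\mu_{\rho'}^D=\mathrm{Ad}[U]\circ(\pi_0\otimes\mathrm{id})\circ\mu_\rho^D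 .$$ Moreover $U$ can be taken to be the limit of $(\pi_0\otimes\mathrm{id})(\mathbf F^D_{\overline{\sigma_m}})$ as $m\to\infty$ in the strong-$*$ operator topology. -/

import Mathlib

open scoped Matrix ComplexOrder InnerProductSpace
open Filter Topology

/-! ## The triangular lattice -/

/-- Vertices of the triangular lattice, in the lattice basis `(1, 0)`, `(1/2, √3/2)` of the plane. -/
abbrev Vertex : Type := ℤ × ℤ

/-- The edges of the triangular lattice. Every edge is oriented towards the right; in direction
`0` it points along `(1, 0)`, in direction `1` along `(1/2, √3/2)`, in direction `2` along
`(1/2, -√3/2)`. -/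
structure Edge where
  /-- the origin of the edge -/
  source : Vertex
  /-- the direction of the edge -/
  dir : Fin 3
deriving DecidableEq

/-- The end point of an edge. -/
def Edge.target (e : Edge) : Vertex :=
  ![(e.source.1 + 1, e.source.2), (e.source.1, e.source.2 + 1),
    (e.source.1 + 1, e.source.2 - 1)] e.dir

/-- The faces of the triangular lattice: `up a b` is the triangle pointing upwards with corners
`(a, b)`, `(a + 1, b)`, `(a, b + 1)`, and `down a b` is the triangle pointing downwards with
corners `(a + 1, b)`, `(a + 1, b + 1)`, `(a, b + 1)` (in lattice coordinates). -/
inductive Face where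
  | up (a b : ℤ)
  | down (a b : ℤ)
deriving DecidableEq

/-- The corners of a face. -/
def Face.corners : Face → Set Vertex
  | .up a b => {(a, b), (a + 1, b), (a, b + 1)}
  | .down a b => {(a + 1, b), (a + 1, b + 1), (a, b + 1)}

/-- The face to the left of an edge. -/
def Edge.left (e : Edge) : Face :=
  ![.up e.source.1 e.source.2, .down (e.source.1 - 1) e.source.2,
    .down e.source.1 (e.source.2 - 1)] e.dir

/-- The face to the right of an edge. -/
def Edge.right (e : Edge) : Face :=
  ![.down e.source.1 (e.source.2 - 1), .up e.source.1 e.source.2,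
    .up e.source.1 (e.source.2 - 1)] e.dir

/-- The Euclidean plane. -/
abbrev Plane : Type := EuclideanSpace ℝ (Fin 2)

/-- The position of a vertex in the plane. -/
noncomputable def Vertex.pos (v : Vertex) : Plane :=
  !₂[(v.1 : ℝ) + (v.2 : ℝ) / 2, √3 / 2 * (v.2 : ℝ)]

/-- The midpoint of an edge in the plane. -/
noncomputable def Edge.mid (e : Edge) : Plane :=
  midpoint ℝ (Vertex.pos e.source) (Vertex.pos e.target)

/-- The set of edges whose midpoints lie in a region of the plane. -/
def edgesIn (S : Set Plane) : Set Edge := {e | e.mid ∈ S}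

/-- Cones in the plane: the open cones with apex `a`, axis `v` (a unit vector) and opening angle
`θ ∈ (0, 2π)`, and their closed versions. This class of sets is closed under complements. -/
def IsCone (Λ : Set Plane) : Prop :=
  ∃ (a v : Plane) (θ : ℝ), ‖v‖ = 1 ∧ 0 < θ ∧ θ < 2 * Real.pi ∧
    (Λ = {x | ‖x - a‖ * Real.cos (θ / 2) < ⟪v, x - a⟫_ℝ} ∨
     Λ = {x | ‖x - a‖ * Real.cos (θ / 2) ≤ ⟪v, x - a⟫_ℝ})

/-! ## Sites, triangles and ribbons -/

/-- A site is a pair of a face and one of its corners. -/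
@[ext] structure Site where
  /-- the vertex of the site -/
  vertex : Vertex
  /-- the face of the site -/
  face : Face
  mem : vertex ∈ face.corners

/-- Direct and dual triangles `(s₀, s₁, e)`. In a direct triangle, the two sites share their face
and `e` connects their vertices. In a dual triangle, the two sites share their vertex and the dual
edge of `e`, which crosses `e` from right to left, connects their faces. -/
inductive Triangle where
  | direct (s₀ s₁ : Site) (e : Edge) (hface : s₀.face = s₁.face)
      (he : (s₀.vertex = e.source ∧ s₁.vertex = e.target) ∨
            (s₀.vertex = e.target ∧ s₁.vertex = e.source))
  | dual (s₀ s₁ : Site) (e : Edge) (hvertex : s₀.vertex = s₁.vertex)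
      (he : (s₀.face = e.right ∧ s₁.face = e.left) ∨ (s₀.face = e.left ∧ s₁.face = e.right))

namespace Triangle

/-- The initial site of a triangle. -/
def first : Triangle → Site
  | direct s₀ _ _ _ _ => s₀
  | dual s₀ _ _ _ _ => s₀

/-- The final site of a triangle. -/
def final : Triangle → Site
  | direct _ s₁ _ _ _ => s₁
  | dual _ s₁ _ _ _ => s₁

/-- The edge of a triangle. -/
def edge : Triangle → Edge
  | direct _ _ e _ _ => e
  | dual _ _ e _ _ => e

/-- The opposite triangle. -/
def opp : Triangle → Triangle
  | direct s₀ s₁ e hf he =>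
      direct s₁ s₀ e hf.symm (he.elim (fun h => Or.inr ⟨h.2, h.1⟩) (fun h => Or.inl ⟨h.2, h.1⟩))
  | dual s₀ s₁ e hv he =>
      dual s₁ s₀ e hv.symm (he.elim (fun h => Or.inr ⟨h.2, h.1⟩) (fun h => Or.inl ⟨h.2, h.1⟩))

/-- A direct triangle is positive if its face lies to the right of its edge, oriented from the
vertex of the initial site to that of the final site. A dual triangle is positive if its vertex
lies to the left of its dual edge, oriented from the face of the initial site to that of the final
site (the origin of `e` lies to the left of the dual edge crossing `e` from right to left). -/
def IsPositive : Triangle → Prop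
  | direct s₀ s₁ e _ _ =>
      (s₀.vertex = e.source ∧ s₁.vertex = e.target ∧ s₀.face = e.right) ∨
      (s₀.vertex = e.target ∧ s₁.vertex = e.source ∧ s₀.face = e.left)
  | dual s₀ s₁ e _ _ =>
      (s₀.face = e.right ∧ s₁.face = e.left ∧ s₀.vertex = e.source) ∨
      (s₀.face = e.left ∧ s₁.face = e.right ∧ s₀.vertex = e.target)

end Triangle

/-- A list of triangles is a (finite) ribbon if consecutive triangles fit together and no edge
belongs to more than one of the triangles. -/
def IsRibbon (ρ : List Triangle) : Prop :=
  ρ.IsChain (fun τ τ' => τ.final = τ'.first) ∧ (ρ.map Triangle.edge).Nodup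

/-- The opposite ribbon. -/
def oppRibbon (ρ : List Triangle) : List Triangle := (ρ.map Triangle.opp).reverse

/-- A finite ribbon is supported in a region if the midpoints of all its edges lie there. -/
def RibbonIn (ρ : List Triangle) (S : Set Plane) : Prop := ∀ τ ∈ ρ, τ.edge ∈ edgesIn S

/-- A half-infinite ribbon. The triangles are numbered from `0` here. -/
structure HalfInfiniteRibbon where
  /-- the sequence of triangles -/
  tri : ℕ → Triangle
  chain : ∀ k, (tri k).final = (tri (k + 1)).first
  edge_injective : Function.Injective fun k => (tri k).edge

namespace HalfInfiniteRibbon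

/-- The finite ribbon consisting of the first `m` triangles of `ρ`. -/
def initial (ρ : HalfInfiniteRibbon) (m : ℕ) : List Triangle := (List.range m).map ρ.tri

/-- Positive half-infinite ribbons. -/
def IsPositive (ρ : HalfInfiniteRibbon) : Prop := ∀ k, (ρ.tri k).IsPositive

/-- Negative half-infinite ribbons. -/
def IsNegative (ρ : HalfInfiniteRibbon) : Prop := ∀ k, ¬ (ρ.tri k).IsPositive

/-- A half-infinite ribbon is supported in a region if the midpoints of all its edges lie there. -/
def SupportedIn (ρ : HalfInfiniteRibbon) (S : Set Plane) : Prop :=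
  ∀ k, (ρ.tri k).edge ∈ edgesIn S

end HalfInfiniteRibbon

/-- The concatenation `σ_m` of `ρ_m`, `ξ_m` and the opposite of `ρ'_m`. -/
def intertwiningRibbon (ρ ρ' : HalfInfiniteRibbon) (ξ : ℕ → List Triangle) (m : ℕ) :
    List Triangle :=
  ρ.initial m ++ ξ m ++ oppRibbon (ρ'.initial m)

/-- `ξ_1, ξ_2, …` is a bridge from `ρ` to `ρ'` (the value `ξ 0` plays no role). -/
structure IsBridge (ρ ρ' : HalfInfiniteRibbon) (ξ : ℕ → List Triangle) : Prop where
  ribbon : ∀ m, 1 ≤ m → IsRibbon (ξ m)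
  concat : ∀ m, 1 ≤ m → IsRibbon (intertwiningRibbon ρ ρ' ξ m)
  escapes : ∀ (x : Plane) (r : ℝ), ∀ᶠ m in atTop, RibbonIn (ξ m) (Metric.ball x r)ᶜ

/-! ## The quantum double algebra of a finite group -/

/-- The quantum double algebra `𝒟(G)`: the element `a` stands for the formal linear combination
`∑ a(g, h) (g, h)`. -/
structure QuantumDouble (G : Type*) where
  /-- the coefficients -/
  coeff : G → G → ℂ

namespace QuantumDouble

variable {G : Type*}

@[ext] theorem ext {a b : QuantumDouble G} (h : ∀ x y, a.coeff x y = b.coeff x y) : a = b := by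
  cases a; cases b; congr; funext x y; exact h x y

instance : Zero (QuantumDouble G) := ⟨⟨fun _ _ => 0⟩⟩
instance : Add (QuantumDouble G) := ⟨fun a b => ⟨fun x y => a.coeff x y + b.coeff x y⟩⟩
instance : Neg (QuantumDouble G) := ⟨fun a => ⟨fun x y => -a.coeff x y⟩⟩
instance : SMul ℂ (QuantumDouble G) := ⟨fun c a => ⟨fun x y => c * a.coeff x y⟩⟩

/-- The basis element `(g, h)`. -/
def of [DecidableEq G] (g h : G) : QuantumDouble G := ⟨fun x y => if x = g ∧ y = h then 1 else 0⟩

variable [Group G] [Fintype G] [DecidableEq G]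

/-- The bilinear extension of `(g₁, h₁) (g₂, h₂) = δ_{g₁, h₁ g₂ h₁⁻¹} (g₁, h₁ h₂)`. -/
instance : Mul (QuantumDouble G) :=
  ⟨fun a b => ⟨fun g h => ∑ k, a.coeff g k * b.coeff (k⁻¹ * g * k) (k⁻¹ * h)⟩⟩

/-- The unit `∑ₖ (k, 1)`. -/
instance : One (QuantumDouble G) := ⟨⟨fun _ h => if h = 1 then 1 else 0⟩⟩

/-- The antilinear extension of `(g, h)* = (h⁻¹ g h, h⁻¹)`. -/
instance : Star (QuantumDouble G) := ⟨fun a => ⟨fun g h => star (a.coeff (h⁻¹ * g * h) h⁻¹)⟩⟩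

@[simp] theorem coeff_zero (g h : G) : (0 : QuantumDouble G).coeff g h = 0 := rfl
@[simp] theorem coeff_add (a b : QuantumDouble G) (g h : G) :
    (a + b).coeff g h = a.coeff g h + b.coeff g h := rfl
@[simp] theorem coeff_neg (a : QuantumDouble G) (g h : G) : (-a).coeff g h = -a.coeff g h := rfl
@[simp] theorem coeff_smul (c : ℂ) (a : QuantumDouble G) (g h : G) :
    (c • a).coeff g h = c * a.coeff g h := rfl
theorem coeff_mul (a b : QuantumDouble G) (g h : G) :
    (a * b).coeff g h = ∑ k, a.coeff g k * b.coeff (k⁻¹ * g * k) (k⁻¹ * h) := rfl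
theorem coeff_one (g h : G) : (1 : QuantumDouble G).coeff g h = if h = 1 then 1 else 0 := rfl
@[simp] theorem coeff_star (a : QuantumDouble G) (g h : G) :
    (star a).coeff g h = star (a.coeff (h⁻¹ * g * h) h⁻¹) := rfl
theorem coeff_of (g h x y : G) : (of g h).coeff x y = if x = g ∧ y = h then 1 else 0 := rfl

protected theorem mul_assoc (a b c : QuantumDouble G) : a * b * c = a * (b * c) := by
  ext g h
  simp only [coeff_mul, Finset.sum_mul, Finset.mul_sum]
  rw [Finset.sum_comm]
  refine Finset.sum_congr rfl fun k _ => ?_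
  refine (Fintype.sum_equiv (Equiv.mulLeft k) _ _ fun l => ?_).symm
  simp [mul_assoc]

protected theorem one_mul (a : QuantumDouble G) : 1 * a = a := by
  ext g h; simp [coeff_mul, coeff_one]

protected theorem mul_one (a : QuantumDouble G) : a * 1 = a := by
  ext g h; simp [coeff_mul, coeff_one, inv_mul_eq_one]

instance : Ring (QuantumDouble G) where
  add_assoc a b c := by ext; simp [add_assoc]
  zero_add a := by ext; simp
  add_zero a := by ext; simp
  add_comm a b := by ext; simp [add_comm]
  neg_add_cancel a := by ext; simp
  nsmul := nsmulRec
  zsmul := zsmulRec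
  mul_assoc := QuantumDouble.mul_assoc
  one_mul := QuantumDouble.one_mul
  mul_one := QuantumDouble.mul_one
  left_distrib a b c := by ext; simp [coeff_mul, mul_add, Finset.sum_add_distrib]
  right_distrib a b c := by ext; simp [coeff_mul, add_mul, Finset.sum_add_distrib]
  zero_mul a := by ext; simp [coeff_mul]
  mul_zero a := by ext; simp [coeff_mul]

instance : Module ℂ (QuantumDouble G) where
  one_smul a := by ext; simp
  mul_smul c d a := by ext; simp [mul_assoc]
  smul_zero c := by ext; simp
  smul_add c a b := by ext; simp [mul_add]
  add_smul c d a := by ext; simp [add_mul]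
  zero_smul a := by ext; simp

instance : Algebra ℂ (QuantumDouble G) :=
  Algebra.ofModule
    (fun c a b => by ext; simp [coeff_mul, Finset.mul_sum, mul_assoc])
    (fun c a b => by ext; simp [coeff_mul, Finset.mul_sum, mul_left_comm])

instance : StarRing (QuantumDouble G) where
  star_involutive a := by ext; simp [mul_assoc]
  star_mul a b := by
    ext g h
    simp only [coeff_mul, coeff_star, star_sum, star_mul']
    refine Fintype.sum_equiv (Equiv.mulLeft h) _ _ fun k => ?_
    simp [mul_assoc, mul_comm]
  star_add a b := by ext; simp

theorem of_mul_of (g₁ h₁ g₂ h₂ : G) :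
    of g₁ h₁ * of g₂ h₂ = if g₁ = h₁ * g₂ * h₁⁻¹ then of g₁ (h₁ * h₂) else 0 := by
  ext x y
  rw [coeff_mul, Finset.sum_eq_single h₁]
  · by_cases hx : x = g₁
    · subst hx
      by_cases hg : x = h₁ * g₂ * h₁⁻¹
      · simp [coeff_of, hg, mul_assoc, inv_mul_eq_iff_eq_mul]
      · have : ¬ h₁⁻¹ * x * h₁ = g₂ := fun h => hg (by rw [← h]; group)
        simp [coeff_of, hg, this]
    · split_ifs <;> simp [coeff_of, hx]
  · intro b _ hb; simp [coeff_of, hb]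
  · simp

theorem star_of (g h : G) : star (of g h) = of (h⁻¹ * g * h) h⁻¹ := by
  ext x y
  simp only [coeff_star, coeff_of]
  by_cases hy : y = h⁻¹
  · subst hy
    have : (h * x * h⁻¹ = g) ↔ (x = h⁻¹ * g * h) := by
      constructor
      · rintro rfl; group
      · rintro rfl; group
    simp [this, apply_ite star]
  · have : ¬ y⁻¹ = h := fun h' => hy (by rw [← h', inv_inv])
    simp [hy, this]

end QuantumDouble

/-! ## The quasi-local algebra

It is realised on the Hilbert space spanned by the configurations of group elements on the edges
which are trivial away from finitely many edges (the infinite tensor product of the `ℂ[G]` along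
the reference vectors `|1⟩`). -/

/-- Configurations of group elements that are trivial on all but finitely many edges. -/
abbrev Config (G : Type*) [Group G] : Type _ := {c : Edge → G // {e | c e ≠ 1}.Finite}

/-- The configuration that agrees with `c` away from `e` and takes the value `g` on `e`. -/
def Config.set {G : Type*} [Group G] (c : Config G) (e : Edge) (g : G) : Config G :=
  ⟨Function.update c.1 e g, (c.2.insert e).subset fun e' he' => by
    by_cases h : e' = e
    · exact Or.inl h
    · exact Or.inr (by simpa [Function.update_of_ne h] using he')⟩

/-- The Hilbert space with orthonormal basis the configurations. -/
abbrev RefSpace (G : Type*) [Group G] : Type _ := lp (fun _ : Config G => ℂ) 2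

section MatrixUnits

variable {G : Type*} [Group G] [DecidableEq G]

theorem Config.set_injOn (e : Edge) (g h : G) :
    Set.InjOn (fun c : Config G => c.set e h) {c | c.1 e = g} := by
  intro c hc c' hc' heq
  apply Subtype.ext
  funext e'
  by_cases he : e' = e
  · subst he; exact hc.trans hc'.symm
  · have := congrFun (congrArg Subtype.val heq) e'
    simpa [Config.set, Function.update_of_ne he] using this

/-- The function underlying the action of `|g⟩⟨h|` on the edge `e`. -/
def matUnitFun (e : Edge) (g h : G) (ψ : Config G → ℂ) (c : Config G) : ℂ :=
  if c.1 e = g then ψ (c.set e h) else 0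

theorem matUnit_sum_le (e : Edge) (g h : G) (ψ : RefSpace G) (s : Finset (Config G)) :
    ∑ c ∈ s, ‖matUnitFun e g h ψ c‖ ^ (2 : ENNReal).toReal ≤ ‖ψ‖ ^ (2 : ENNReal).toReal := by
  classical
  have h2 : (0 : ℝ) < (2 : ENNReal).toReal := by simp
  have hinj : Set.InjOn (fun c : Config G => c.set e h) (s.filter fun c => c.1 e = g) := by
    intro c hc c' hc' heq
    simp only [Finset.coe_filter, Set.mem_ofPred_eq] at hc hc'
    exact Config.set_injOn e g h hc.2 hc'.2 heq
  have : ∑ c ∈ s, ‖matUnitFun e g h ψ c‖ ^ (2 : ENNReal).toReal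
      = ∑ c ∈ (s.filter fun c => c.1 e = g).image (fun c : Config G => c.set e h),
          ‖ψ c‖ ^ (2 : ENNReal).toReal := by
    rw [Finset.sum_image hinj, Finset.sum_filter]
    refine Finset.sum_congr rfl fun c _ => ?_
    unfold matUnitFun
    split_ifs <;> simp
  rw [this]
  exact lp.sum_rpow_le_norm_rpow h2 ψ _

/-- The operator `|g⟩⟨h|` on the edge `e`. -/
noncomputable def matUnitOp (e : Edge) (g h : G) : RefSpace G →L[ℂ] RefSpace G :=
  LinearMap.mkContinuous
    { toFun := fun ψ => ⟨matUnitFun e g h ψ, memℓp_gen' (matUnit_sum_le e g h ψ)⟩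
      map_add' := fun ψ φ => by
        ext c
        simp only [lp.coeFn_add, Pi.add_apply, matUnitFun]
        split_ifs <;> simp
      map_smul' := fun z ψ => by
        ext c
        simp only [lp.coeFn_smul, Pi.smul_apply, matUnitFun, RingHom.id_apply]
        split_ifs <;> simp }
    1
    (fun ψ => by
      rw [one_mul]
      exact lp.norm_le_of_forall_sum_le (by simp) (norm_nonneg _) (matUnit_sum_le e g h ψ))

variable (G) in
/-- The algebra of observables supported on the set `X` of edges: the norm closure of the
`*`-algebra generated by the matrix algebras of the edges in `X`. -/
noncomputable def localAlgebra (X : Set Edge) :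
    StarSubalgebra ℂ (RefSpace G →L[ℂ] RefSpace G) :=
  (StarAlgebra.adjoin ℂ {T | ∃ e ∈ X, ∃ g h : G, T = matUnitOp e g h}).topologicalClosure

variable (G) in
/-- The quasi-local algebra `𝒜`. -/
noncomputable abbrev quasiLocal : StarSubalgebra ℂ (RefSpace G →L[ℂ] RefSpace G) :=
  localAlgebra G Set.univ

/-- The matrix unit `|g⟩⟨h|` of the edge `e`, as an element of `𝒜`. -/
noncomputable def matUnit (e : Edge) (g h : G) : quasiLocal G :=
  ⟨matUnitOp e g h, StarSubalgebra.le_topologicalClosure _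
    (StarAlgebra.subset_adjoin ℂ _ ⟨e, Set.mem_univ e, g, h, rfl⟩)⟩

end MatrixUnits

section Ribbons

variable {G : Type*} [Group G] [Fintype G] [DecidableEq G]

/-! ## Ribbon operators -/

/-- `L_e^h = ∑_g |hg⟩⟨g|`. -/
noncomputable def edgeL (e : Edge) (h : G) : quasiLocal G := ∑ g, matUnit e (h * g) g

/-- `R_e^h = ∑_g |g h⁻¹⟩⟨g|`. -/
noncomputable def edgeR (e : Edge) (h : G) : quasiLocal G := ∑ g, matUnit e (g * h⁻¹) g

/-- `T_e^g = |g⟩⟨g|`. -/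
noncomputable def edgeT (e : Edge) (g : G) : quasiLocal G := matUnit e g g

/-- The ribbon operators `F_τ^{h,g}` of a single triangle: `T_τ^g` for a direct triangle and
`δ_{g,1} L_τ^h` for a dual triangle. -/
noncomputable def triangleOp (τ : Triangle) (h g : G) : quasiLocal G :=
  match τ with
  | .direct s₀ _ e _ _ => if s₀.vertex = e.source then edgeT e g else edgeT e g⁻¹
  | .dual s₀ _ e _ _ =>
      if g = 1 then
        if s₀.face = e.right then
          if s₀.vertex = e.source then edgeL e h else edgeR e h⁻¹
        else
          if s₀.vertex = e.source then edgeL e h⁻¹ else edgeR e h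
      else 0

/-- The ribbon operators `F_ρ^{h,g}`. -/
noncomputable def ribbonOp : List Triangle → G → G → quasiLocal G
  | [], _, g => if g = 1 then 1 else 0
  | τ :: ρ, h, g => ∑ k, triangleOp τ h k * ribbonOp ρ (k⁻¹ * h * k) (k⁻¹ * g)

/-- The ribbon multiplet `𝐅_ρ^D = ∑_{g,h} F_ρ^{g,h} ⊗ D(g, h)`, a matrix over `𝒜`. -/
noncomputable def ribbonMultiplet {n : ℕ}
    (D : QuantumDouble G →⋆ₐ[ℂ] Matrix (Fin n) (Fin n) ℂ) (ρ : List Triangle) :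
    Matrix (Fin n) (Fin n) (quasiLocal G) :=
  Matrix.of fun i j => ∑ g, ∑ h, D (QuantumDouble.of g h) i j • ribbonOp ρ g h

/-- `μ_ρ^D(O) = 𝐅_ρ^D (O ⊗ 1) (𝐅_ρ^D)*` for a finite ribbon `ρ`. -/
noncomputable def finiteAmpli {n : ℕ}
    (D : QuantumDouble G →⋆ₐ[ℂ] Matrix (Fin n) (Fin n) ℂ) (ρ : List Triangle)
    (O : quasiLocal G) : Matrix (Fin n) (Fin n) (quasiLocal G) :=
  ribbonMultiplet D ρ * Matrix.diagonal (fun _ => O) * (ribbonMultiplet D ρ)ᴴ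

/-- `μ_ρ^D(O) = lim_m μ_{ρ_m}^D(O)` for a half-infinite ribbon `ρ`. -/
noncomputable def ampli {n : ℕ}
    (D : QuantumDouble G →⋆ₐ[ℂ] Matrix (Fin n) (Fin n) ℂ) (ρ : HalfInfiniteRibbon)
    (O : quasiLocal G) : Matrix (Fin n) (Fin n) (quasiLocal G) :=
  limUnder atTop fun m => finiteAmpli D (ρ.initial m) O

/-! ## The ground state and the cone algebras -/

/-- The counterclockwise closed dual ribbon around the vertex `(a, b)`, starting at the site with
face `up a b`. -/
def starRibbon (a b : ℤ) : List Triangle :=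
  let s₀ : Site := ⟨(a, b), .up a b, by simp [Face.corners]⟩
  let s₁ : Site := ⟨(a, b), .down (a - 1) b, by simp [Face.corners]⟩
  let s₂ : Site := ⟨(a, b), .up (a - 1) b, by simp [Face.corners]⟩
  let s₃ : Site := ⟨(a, b), .down (a - 1) (b - 1), by simp [Face.corners]⟩
  let s₄ : Site := ⟨(a, b), .up a (b - 1), by simp [Face.corners]⟩
  let s₅ : Site := ⟨(a, b), .down a (b - 1), by simp [Face.corners]⟩
  [.dual s₀ s₁ ⟨(a, b), 1⟩ rfl (by simp [s₀, s₁, Edge.left, Edge.right]),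
   .dual s₁ s₂ ⟨(a - 1, b + 1), 2⟩ rfl (by simp [s₁, s₂, Edge.left, Edge.right]),
   .dual s₂ s₃ ⟨(a - 1, b), 0⟩ rfl (by simp [s₂, s₃, Edge.left, Edge.right]),
   .dual s₃ s₄ ⟨(a, b - 1), 1⟩ rfl (by simp [s₃, s₄, Edge.left, Edge.right]),
   .dual s₄ s₅ ⟨(a, b), 2⟩ rfl (by simp [s₄, s₅, Edge.left, Edge.right]),
   .dual s₅ s₀ ⟨(a, b), 0⟩ rfl (by simp [s₅, s₀, Edge.left, Edge.right])]

/-- The counterclockwise closed direct ribbon around a face. -/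
def plaquetteRibbon : Face → List Triangle
  | .up a b =>
    let s₀ : Site := ⟨(a, b), .up a b, by simp [Face.corners]⟩
    let s₁ : Site := ⟨(a + 1, b), .up a b, by simp [Face.corners]⟩
    let s₂ : Site := ⟨(a, b + 1), .up a b, by simp [Face.corners]⟩
    [.direct s₀ s₁ ⟨(a, b), 0⟩ rfl (by simp [s₀, s₁, Edge.target]),
     .direct s₁ s₂ ⟨(a, b + 1), 2⟩ rfl (by simp [s₁, s₂, Edge.target]),
     .direct s₂ s₀ ⟨(a, b), 1⟩ rfl (by simp [s₂, s₀, Edge.target])]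
  | .down a b =>
    let s₀ : Site := ⟨(a + 1, b), .down a b, by simp [Face.corners]⟩
    let s₁ : Site := ⟨(a + 1, b + 1), .down a b, by simp [Face.corners]⟩
    let s₂ : Site := ⟨(a, b + 1), .down a b, by simp [Face.corners]⟩
    [.direct s₀ s₁ ⟨(a + 1, b), 1⟩ rfl (by simp [s₀, s₁, Edge.target]),
     .direct s₁ s₂ ⟨(a, b + 1), 0⟩ rfl (by simp [s₁, s₂, Edge.target]),
     .direct s₂ s₀ ⟨(a, b + 1), 2⟩ rfl (by simp [s₂, s₀, Edge.target])]

variable (G) in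
/-- The star operator `A_v = |G|⁻¹ ∑_h A_v^h`. -/
noncomputable def starOp (v : Vertex) : quasiLocal G :=
  (Fintype.card G : ℂ)⁻¹ • ∑ h : G, ribbonOp (starRibbon v.1 v.2) h 1

variable (G) in
/-- The plaquette operator `B_f`, the projection onto trivial flux at `f`. -/
noncomputable def plaquetteOp (f : Face) : quasiLocal G :=
  ribbonOp (plaquetteRibbon f) 1 1

/-- `ω` is a state on `𝒜` with `ω(A_v) = ω(B_f) = 1` for all vertices `v` and faces `f`. -/
structure IsFrustrationFreeGroundState (ω : quasiLocal G →ₗ[ℂ] ℂ) : Prop where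
  nonneg : ∀ a, 0 ≤ ω (star a * a)
  map_one : ω 1 = 1
  star_eq_one : ∀ v, ω (starOp G v) = 1
  plaquette_eq_one : ∀ f, ω (plaquetteOp G f) = 1

variable {H : Type*} [NormedAddCommGroup H] [InnerProductSpace ℂ H] [CompleteSpace H]

/-- `(π, H, Ω)` is a GNS triple of the functional `ω`: a cyclic representation with cyclic vector
`Ω` such that `ω(a) = ⟪Ω, π(a) Ω⟫`. It is unique up to unitary equivalence. -/
structure IsGNSTriple (ω : quasiLocal G →ₗ[ℂ] ℂ) (π : quasiLocal G →⋆ₐ[ℂ] (H →L[ℂ] H)) (Ω : H) :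
    Prop where
  vector_state : ∀ a, ω a = ⟪Ω, π a Ω⟫_ℂ
  cyclic : Dense (Set.range fun a => π a Ω)

/-- The cone algebra `ℛ(Λ) = π(𝒜_Λ)''`. -/
def coneAlgebra (π : quasiLocal G →⋆ₐ[ℂ] (H →L[ℂ] H)) (Λ : Set Plane) : Set (H →L[ℂ] H) :=
  Set.centralizer (Set.centralizer
    (π '' {a | (a : RefSpace G →L[ℂ] RefSpace G) ∈ localAlgebra G (edgesIn Λ)}))

end Ribbons

/-! The multiplets turn concatenation of ribbons into multiplication, are unitary, and turn reversal
into the adjoint (`ribbonMultiplet_append`, `ribbonMultiplet_mem_unitary`,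
`ribbonMultiplet_oppRibbon`). The reason is that the recursion for `F_ρ^{h,g}` is dual to the
product of `𝒟(G)`. Hence `F(σ̄_m) = F(ρ'_m) F(ξ̄_m) F(ρ_m)*`. As soon as `ξ_m` has left the support
of a local observable `O`, this unitary intertwines the finite amplimorphisms of `ρ_m` and `ρ'_m` at
`O` exactly (`oppMultiplet_mul_finiteAmpli`). These finite amplimorphisms are eventually constant in
`m`, so what remains is the strong convergence of `F(σ_m)` and `F(σ̄_m)`.

All entries have norm at most one, so convergence need only be checked on the dense set of vectors
`π₀(O)Ω` with `O` local. Cut `σ_m` at a number `K` beyond which neither half-infinite ribbon meets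
the support of `O`. For large `m` the middle part commutes with `O` and with the last part, and
therefore acts directly on `Ω`. It suffices that this action becomes independent of `m`
(`middleRibbon_apply_ground_vector`).

This is path independence of ribbon operators in the ground state
(`ribbonOp_apply_ground_vector_eq`). The state `Ω` is flat and gauge invariant. On a flat
configuration with potential `k`, a ribbon operator fixes the holonomy between its end points and
multiplies each crossed edge by a power of one group element `H`, transported by `k`. For two
ribbons with the same end sites, the difference of the crossing numbers is the jump of a winding
function `w`, so the two results differ by the gauge transformation `k⁻¹ H^w k`. The ground state
absorbs it, provided that `w` vanishes at the end points.

The cone ensures this vanishing. For large `m`, two middle parts differ only in triangles whose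
edges lie in `Λ` and far from the apex. A ray from an end point opposite to the axis of the cone
avoids these edges and reaches the region where `w = 0` (`IsCone.eq_zero_of_jumps`). -/

set_option linter.unusedSectionVars false

/-! ## Matrix units on basis vectors -/

section Kets

variable {G : Type*} [Group G] [DecidableEq G]

open Classical in
/-- The basis vector of a configuration. -/
noncomputable def ket (c : Config G) : RefSpace G := lp.single 2 c (1 : ℂ)

open Classical in
theorem ket_apply (c c' : Config G) : (ket c : Config G → ℂ) c' = if c' = c then 1 else 0 := by
  rw [ket, lp.single_apply]
  by_cases h : c' = c
  · subst h; simp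
  · simp [h]

@[simp] theorem Config.set_apply (c : Config G) (e : Edge) (g : G) (e' : Edge) :
    (c.set e g).1 e' = if e' = e then g else c.1 e' := by
  simp [Config.set, Function.update_apply]

theorem Config.ext_iff' {c c' : Config G} : c = c' ↔ ∀ e, c.1 e = c'.1 e :=
  ⟨fun h _ => h ▸ rfl, fun h => Subtype.ext (funext h)⟩

theorem matUnitOp_apply (e : Edge) (g h : G) (ψ : RefSpace G) (c : Config G) :
    (matUnitOp e g h ψ : Config G → ℂ) c = if c.1 e = g then ψ (c.set e h) else 0 := rfl

theorem matUnitOp_ket (e : Edge) (g h : G) (c : Config G) :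
    matUnitOp e g h (ket c) = if c.1 e = h then ket (c.set e g) else 0 := by
  classical
  ext c'
  have key : (c'.1 e = g ∧ c'.set e h = c) ↔ (c.1 e = h ∧ c' = c.set e g) := by
    simp only [Config.ext_iff', Config.set_apply]
    constructor
    · rintro ⟨h1, h2⟩
      refine ⟨by simpa using (h2 e).symm, fun e' => ?_⟩
      have := h2 e'
      split_ifs at this ⊢ with he
      · rw [he, h1]
      · exact this
    · rintro ⟨h1, h2⟩
      refine ⟨by simpa using h2 e, fun e' => ?_⟩
      have := h2 e'
      split_ifs at this ⊢ with he
      · rw [he, h1]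
      · exact this
  rw [matUnitOp_apply, ket_apply, ← ite_and]
  simp only [key, ite_and]
  by_cases h1 : c.1 e = h
  · simp [h1, ket_apply]
  · simp [h1]

theorem inner_ket_left (c : Config G) (ψ : RefSpace G) : ⟪ket c, ψ⟫_ℂ = ψ c := by
  classical
  rw [ket, lp.inner_single_left]; simp

theorem continuousLinearMap_ext_ket {F : Type*} [NormedAddCommGroup F] [NormedSpace ℂ F]
    {S T : RefSpace G →L[ℂ] F} (h : ∀ c, S (ket c) = T (ket c)) : S = T := by
  classical
  ext ψ
  have hs : HasSum (fun c => lp.single 2 c (ψ c)) ψ := lp.hasSum_single ENNReal.ofNat_ne_top ψ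
  have hk : ∀ c, lp.single 2 c (ψ c) = ψ c • ket c := fun c => by
    rw [ket, ← lp.single_smul]; simp
  simp only [hk] at hs
  have h1 := S.hasSum hs
  have h2 := T.hasSum hs
  simp only [map_smul, h] at h1 h2
  exact h1.unique h2

theorem quasiLocal_ext {a b : quasiLocal G}
    (h : ∀ c, (a : RefSpace G →L[ℂ] RefSpace G) (ket c) = (b : RefSpace G →L[ℂ] RefSpace G) (ket c)) :
    a = b :=
  Subtype.ext (continuousLinearMap_ext_ket h)

theorem star_eq_of_inner_ket {S T : RefSpace G →L[ℂ] RefSpace G}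
    (h : ∀ c c', ⟪S (ket c), ket c'⟫_ℂ = ⟪ket c, T (ket c')⟫_ℂ) : star S = T := by
  refine continuousLinearMap_ext_ket fun c' => ?_
  ext c
  rw [← inner_ket_left, ← inner_ket_left, ContinuousLinearMap.star_eq_adjoint,
    ContinuousLinearMap.adjoint_inner_right, h]

theorem star_matUnitOp (e : Edge) (g h : G) : star (matUnitOp e g h) = matUnitOp e h g := by
  classical
  refine star_eq_of_inner_ket fun c c' => ?_
  rw [inner_ket_left, matUnitOp_apply, matUnitOp_ket]
  split_ifs with h1
  · rw [inner_ket_left, ket_apply]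
  · simp

/-- The action of an observable on the reference Hilbert space. -/
noncomputable def actOn (a : quasiLocal G) (ψ : RefSpace G) : RefSpace G :=
  (a : RefSpace G →L[ℂ] RefSpace G) ψ

theorem quasiLocal_ext_ket {a b : quasiLocal G} (h : ∀ c, actOn a (ket c) = actOn b (ket c)) :
    a = b := quasiLocal_ext h

@[simp] theorem actOn_mul (a b : quasiLocal G) (ψ : RefSpace G) :
    actOn (a * b) ψ = actOn a (actOn b ψ) := rfl
@[simp] theorem actOn_one (ψ : RefSpace G) : actOn (1 : quasiLocal G) ψ = ψ := rfl
@[simp] theorem actOn_zero (ψ : RefSpace G) : actOn (0 : quasiLocal G) ψ = 0 := rfl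
@[simp] theorem actOn_add (a b : quasiLocal G) (ψ : RefSpace G) :
    actOn (a + b) ψ = actOn a ψ + actOn b ψ := rfl
@[simp] theorem actOn_sub (a b : quasiLocal G) (ψ : RefSpace G) :
    actOn (a - b) ψ = actOn a ψ - actOn b ψ := rfl
@[simp] theorem actOn_smul (z : ℂ) (a : quasiLocal G) (ψ : RefSpace G) :
    actOn (z • a) ψ = z • actOn a ψ := rfl
@[simp] theorem actOn_vec_zero (a : quasiLocal G) : actOn a 0 = 0 := map_zero _
theorem actOn_vec_sum {ι : Type*} (s : Finset ι) (a : quasiLocal G) (ψ : ι → RefSpace G) :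
    actOn a (∑ i ∈ s, ψ i) = ∑ i ∈ s, actOn a (ψ i) := map_sum _ _ _
theorem actOn_sum {ι : Type*} (s : Finset ι) (a : ι → quasiLocal G) (ψ : RefSpace G) :
    actOn (∑ i ∈ s, a i) ψ = ∑ i ∈ s, actOn (a i) ψ := by
  classical
  induction s using Finset.induction_on with
  | empty => simp
  | insert i s hi ih => simp [Finset.sum_insert hi, ih]

theorem actOn_matUnit_ket (e : Edge) (g h : G) (c : Config G) :
    actOn (matUnit e g h) (ket c) = if c.1 e = h then ket (c.set e g) else 0 :=
  matUnitOp_ket e g h c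

@[simp] theorem star_matUnit (e : Edge) (g h : G) : star (matUnit e g h) = matUnit e h g :=
  Subtype.ext (star_matUnitOp e g h)

theorem matUnit_mul_matUnit (e : Edge) (g h g' h' : G) :
    matUnit e g h * matUnit e g' h' = if h = g' then matUnit e g h' else 0 := by
  refine quasiLocal_ext_ket fun c => ?_
  rw [actOn_mul, actOn_matUnit_ket]
  by_cases h1 : c.1 e = h'
  · rw [if_pos h1, actOn_matUnit_ket]
    by_cases h2 : h = g'
    · subst h2
      simp only [Config.set_apply, if_true, actOn_matUnit_ket, h1]
      congr 1
      refine Config.ext_iff'.2 fun e' => ?_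
      simp only [Config.set_apply]; split_ifs <;> rfl
    · rw [if_neg h2, if_neg (by simpa using fun h3 => h2 h3.symm)]; rfl
  · rw [if_neg h1, actOn_vec_zero]
    split_ifs with h2
    · rw [actOn_matUnit_ket, if_neg h1]
    · rfl

theorem commute_matUnit {e e' : Edge} (he : e ≠ e') (g h g' h' : G) :
    Commute (matUnit e g h) (matUnit e' g' h') := by
  refine quasiLocal_ext_ket fun c => ?_
  rw [actOn_mul, actOn_mul, actOn_matUnit_ket, actOn_matUnit_ket]
  by_cases h1 : c.1 e = h <;> by_cases h2 : c.1 e' = h' <;>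
    simp [h1, h2, actOn_matUnit_ket, he, he.symm]
  refine congrArg ket (Config.ext_iff'.2 fun e'' => ?_)
  simp only [Config.set_apply]
  split_ifs with h3 h4 <;> simp_all

variable [Fintype G]

theorem sum_matUnit (e : Edge) : ∑ g : G, matUnit e g g = 1 := by
  refine quasiLocal_ext_ket fun c => ?_
  simp only [actOn_sum, actOn_matUnit_ket, Finset.sum_ite_eq, Finset.mem_univ, if_true, actOn_one]
  refine congrArg ket (Config.ext_iff'.2 fun e' => ?_)
  simp only [Config.set_apply]; split_ifs with h <;> simp [h]

theorem actOn_edgeL_ket (e : Edge) (h : G) (c : Config G) :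
    actOn (edgeL e h) (ket c) = ket (c.set e (h * c.1 e)) := by
  simp [edgeL, actOn_sum, actOn_matUnit_ket]

theorem actOn_edgeR_ket (e : Edge) (h : G) (c : Config G) :
    actOn (edgeR e h) (ket c) = ket (c.set e (c.1 e * h⁻¹)) := by
  simp [edgeR, actOn_sum, actOn_matUnit_ket]

theorem actOn_edgeT_ket (e : Edge) (g : G) (c : Config G) :
    actOn (edgeT e g) (ket c) = if c.1 e = g then ket c else 0 := by
  rw [edgeT, actOn_matUnit_ket]
  split_ifs with h
  · refine congrArg ket (Config.ext_iff'.2 fun e' => ?_)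
    simp only [Config.set_apply]; split_ifs with h' <;> simp [h', h]
  · rfl

theorem edgeL_mul (e : Edge) (g h : G) : edgeL e g * edgeL e h = edgeL e (g * h) := by
  refine quasiLocal_ext_ket fun c => ?_
  simp only [actOn_mul, actOn_edgeL_ket]
  refine congrArg ket (Config.ext_iff'.2 fun e' => ?_)
  simp only [Config.set_apply]; split_ifs <;> simp [mul_assoc]

theorem edgeR_mul (e : Edge) (g h : G) : edgeR e g * edgeR e h = edgeR e (g * h) := by
  refine quasiLocal_ext_ket fun c => ?_
  simp only [actOn_mul, actOn_edgeR_ket]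
  refine congrArg ket (Config.ext_iff'.2 fun e' => ?_)
  simp only [Config.set_apply]; split_ifs <;> simp [mul_assoc]

@[simp] theorem edgeL_one (e : Edge) : edgeL e (1 : G) = 1 := by
  simp [edgeL, sum_matUnit]

@[simp] theorem edgeR_one (e : Edge) : edgeR e (1 : G) = 1 := by
  simp [edgeR, sum_matUnit]

theorem star_edgeL (e : Edge) (h : G) : star (edgeL e h) = edgeL e h⁻¹ := by
  simp only [edgeL, star_sum, star_matUnit]
  exact Fintype.sum_equiv (Equiv.mulLeft h) _ _ fun g => by simp

theorem star_edgeR (e : Edge) (h : G) : star (edgeR e h) = edgeR e h⁻¹ := by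
  simp only [edgeR, star_sum, star_matUnit]
  exact Fintype.sum_equiv (Equiv.mulRight h⁻¹) _ _ fun g => by simp

theorem star_edgeT (e : Edge) (h : G) : star (edgeT e h) = edgeT e h := star_matUnit e h h

theorem edgeT_mul (e : Edge) (g h : G) :
    edgeT e g * edgeT e h = if g = h then edgeT e g else 0 := by
  rw [edgeT, edgeT, matUnit_mul_matUnit]
  split_ifs with hg
  · rw [hg]
  · rfl

theorem sum_edgeT (e : Edge) : ∑ g : G, edgeT e g = 1 := sum_matUnit e

theorem edgeL_mem_unitary (e : Edge) (h : G) : edgeL e h ∈ unitary (quasiLocal G) := by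
  constructor <;> rw [star_edgeL, edgeL_mul] <;> simp

theorem edgeR_mem_unitary (e : Edge) (h : G) : edgeR e h ∈ unitary (quasiLocal G) := by
  constructor <;> rw [star_edgeR, edgeR_mul] <;> simp

end Kets

/-! ## Multiplicativity and unitarity of the ribbon multiplets -/

section Multiplets

variable {G : Type*} [Group G] [Fintype G] [DecidableEq G] {n : ℕ}

variable (G n) in
/-- Scalar matrices as matrices over the quasi-local algebra. -/
noncomputable def constMat : Matrix (Fin n) (Fin n) ℂ →+* Matrix (Fin n) (Fin n) (quasiLocal G) :=
  (algebraMap ℂ (quasiLocal G)).mapMatrix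

theorem constMat_apply (M : Matrix (Fin n) (Fin n) ℂ) (i j : Fin n) :
    constMat G n M i j = algebraMap ℂ (quasiLocal G) (M i j) := rfl

/-- The product of a scalar matrix `a` and a constant matrix `M` plays the role of the elementary
tensor `a ⊗ M`. Its two factors commute because the entries of `M` are central in `𝒜`. -/
theorem commute_scalar_constMat (a : quasiLocal G) (M : Matrix (Fin n) (Fin n) ℂ) :
    Commute (Matrix.scalar (Fin n) a) (constMat G n M) := by
  ext i j : 1
  rw [Matrix.scalar_apply, Matrix.diagonal_mul, Matrix.mul_diagonal, constMat_apply]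
  exact (Algebra.commutes _ _).symm

theorem scalar_mul_constMat_mul (a b : quasiLocal G) (M N : Matrix (Fin n) (Fin n) ℂ) :
    (Matrix.scalar (Fin n) a * constMat G n M) * (Matrix.scalar (Fin n) b * constMat G n N)
      = Matrix.scalar (Fin n) (a * b) * constMat G n (M * N) := by
  rw [mul_assoc, ← mul_assoc (constMat G n M), ← (commute_scalar_constMat _ M).eq, mul_assoc,
    ← mul_assoc, map_mul, map_mul]

theorem conjTranspose_scalar (a : quasiLocal G) :
    (Matrix.scalar (Fin n) a)ᴴ = Matrix.scalar (Fin n) (star a) := by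
  rw [Matrix.scalar_apply, Matrix.scalar_apply, Matrix.diagonal_conjTranspose]; rfl

theorem conjTranspose_constMat (M : Matrix (Fin n) (Fin n) ℂ) :
    (constMat G n M)ᴴ = constMat G n Mᴴ := by
  ext i j : 1
  rw [Matrix.conjTranspose_apply, constMat_apply, constMat_apply, Matrix.conjTranspose_apply,
    algebraMap_star_comm]

variable (D : QuantumDouble G →⋆ₐ[ℂ] Matrix (Fin n) (Fin n) ℂ)

/-- The multiplet of a single triangle. -/
noncomputable def triangleMultiplet (τ : Triangle) : Matrix (Fin n) (Fin n) (quasiLocal G) :=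
  ∑ g, ∑ h, Matrix.scalar (Fin n) (triangleOp τ g h) * constMat G n (D (QuantumDouble.of g h))

theorem ribbonMultiplet_eq (ρ : List Triangle) :
    ribbonMultiplet D ρ =
      ∑ g, ∑ h, Matrix.scalar (Fin n) (ribbonOp ρ g h) * constMat G n (D (QuantumDouble.of g h)) := by
  ext i j : 1
  simp only [ribbonMultiplet, Matrix.of_apply, Matrix.sum_apply, Matrix.scalar_apply,
    Matrix.diagonal_mul, constMat_apply]
  refine Finset.sum_congr rfl fun g _ => Finset.sum_congr rfl fun h _ => ?_
  rw [← Algebra.commutes, Algebra.smul_def]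

theorem sum_of_one : ∑ g : G, QuantumDouble.of g 1 = 1 := by
  have hs : ∀ (s : Finset G) (x y : G), (∑ g ∈ s, QuantumDouble.of g (1 : G)).coeff x y
      = ∑ g ∈ s, (QuantumDouble.of g (1 : G)).coeff x y := by
    intro s x y
    induction s using Finset.induction_on with
    | empty => simp
    | insert a s ha ih => simp [Finset.sum_insert ha, ih]
  ext x y
  rw [hs, QuantumDouble.coeff_one]
  simp only [QuantumDouble.coeff_of]
  by_cases hy : y = 1 <;> simp [hy]

@[simp] theorem ribbonMultiplet_nil : ribbonMultiplet D [] = 1 := by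
  rw [ribbonMultiplet_eq]
  have : ∀ g : G, ∑ h, Matrix.scalar (Fin n) (ribbonOp [] g h) *
      constMat G n (D (QuantumDouble.of g h)) = constMat G n (D (QuantumDouble.of g 1)) := by
    intro g
    rw [Finset.sum_eq_single 1]
    · simp [ribbonOp]
    · intro h _ hh; simp [ribbonOp, hh]
    · simp
  simp only [this]
  rw [← map_sum, ← map_sum, sum_of_one, map_one, map_one]

/-- In `𝒟(G)` the product `(g, k) (g', h')` vanishes unless `g' = k⁻¹ g k`. This is the flux label
that the recursion for ribbon operators passes on, so the product of the two multiplets reproduces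
that recursion. -/
theorem ribbonMultiplet_cons (τ : Triangle) (ρ : List Triangle) :
    ribbonMultiplet D (τ :: ρ) = triangleMultiplet D τ * ribbonMultiplet D ρ := by
  rw [ribbonMultiplet_eq, ribbonMultiplet_eq, triangleMultiplet]
  simp only [Finset.sum_mul]
  refine Finset.sum_congr rfl fun g _ => ?_
  simp only [ribbonOp, map_sum, Finset.sum_mul]
  rw [Finset.sum_comm]
  refine Finset.sum_congr rfl fun k _ => ?_
  rw [Finset.mul_sum]
  refine Eq.trans ?_ (Finset.sum_eq_single (k⁻¹ * g * k) ?_ ?_).symm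
  · rw [Finset.mul_sum]
    refine Fintype.sum_equiv (Equiv.mulLeft k⁻¹) _ _ fun h => ?_
    rw [Equiv.coe_mulLeft, scalar_mul_constMat_mul, ← map_mul D, QuantumDouble.of_mul_of,
      if_pos (by group), mul_inv_cancel_left]
  · intro g' _ hg'
    rw [Finset.mul_sum]
    refine Finset.sum_eq_zero fun h _ => ?_
    rw [scalar_mul_constMat_mul, ← map_mul D, QuantumDouble.of_mul_of, if_neg, map_zero, map_zero,
      mul_zero]
    rintro rfl
    exact hg' (by group)
  · simp

theorem ribbonMultiplet_append (ρ ρ' : List Triangle) :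
    ribbonMultiplet D (ρ ++ ρ') = ribbonMultiplet D ρ * ribbonMultiplet D ρ' := by
  induction ρ with
  | nil => simp
  | cons τ ρ ih => rw [List.cons_append, ribbonMultiplet_cons, ribbonMultiplet_cons, ih, mul_assoc]

/-- The operator `L_τ^h` of a dual triangle. -/
noncomputable def dualOp (s₀ : Site) (e : Edge) (h : G) : quasiLocal G :=
  if s₀.face = e.right then
    if s₀.vertex = e.source then edgeL e h else edgeR e h⁻¹
  else
    if s₀.vertex = e.source then edgeL e h⁻¹ else edgeR e h

theorem dualOp_mem_unitary (s₀ : Site) (e : Edge) (h : G) :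
    dualOp s₀ e h ∈ unitary (quasiLocal G) := by
  unfold dualOp
  split_ifs
  exacts [edgeL_mem_unitary _ _, edgeR_mem_unitary _ _, edgeL_mem_unitary _ _,
    edgeR_mem_unitary _ _]

theorem triangleOp_dual (s₀ s₁ : Site) (e : Edge) (hv he) (h g : G) :
    triangleOp (.dual s₀ s₁ e hv he) h g = if g = 1 then dualOp s₀ e h else 0 := rfl

theorem triangleMultiplet_dual (s₀ s₁ : Site) (e : Edge) (hv he) :
    triangleMultiplet D (.dual s₀ s₁ e hv he) =
      ∑ g, Matrix.scalar (Fin n) (dualOp s₀ e g) * constMat G n (D (QuantumDouble.of g 1)) := by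
  refine Finset.sum_congr rfl fun g _ => ?_
  rw [Finset.sum_eq_single 1]
  · simp [triangleOp_dual]
  · intro h _ hh; simp [triangleOp_dual, hh]
  · simp

theorem conjTranspose_scalar_mul_constMat (a : quasiLocal G) (M : Matrix (Fin n) (Fin n) ℂ) :
    (Matrix.scalar (Fin n) a * constMat G n M)ᴴ
      = Matrix.scalar (Fin n) (star a) * constMat G n Mᴴ := by
  rw [Matrix.conjTranspose_mul, conjTranspose_scalar, conjTranspose_constMat,
    (commute_scalar_constMat _ _).eq]

theorem map_of_conjTranspose (g h : G) :
    (D (QuantumDouble.of g h))ᴴ = D (QuantumDouble.of (h⁻¹ * g * h) h⁻¹) := by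
  rw [← QuantumDouble.star_of, map_star]; rfl

/-- Reversal inverts the label of a direct triangle and replaces `L_τ^h` of a dual triangle by its
adjoint. Both match the involution `(g, h)* = (h⁻¹ g h, h⁻¹)` of `𝒟(G)`. -/
theorem triangleMultiplet_opp (τ : Triangle) :
    triangleMultiplet D τ.opp = (triangleMultiplet D τ)ᴴ := by
  cases τ with
  | direct s₀ s₁ e hf he =>
    have hne : e.source ≠ e.target := by
      rcases e with ⟨⟨a, b⟩, d⟩; fin_cases d <;> simp [Edge.target]
    have hop : ∀ g g' h : G, triangleOp (Triangle.direct s₀ s₁ e hf he).opp g h⁻¹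
        = star (triangleOp (Triangle.direct s₀ s₁ e hf he) g' h) := by
      intro g g' h
      rcases he with ⟨h0, h1⟩ | ⟨h0, h1⟩ <;>
        simp [triangleOp, Triangle.opp, h0, h1, hne.symm, star_edgeT]
    simp only [triangleMultiplet, Matrix.conjTranspose_sum, conjTranspose_scalar_mul_constMat,
      map_of_conjTranspose]
    rw [Finset.sum_comm]
    conv_rhs => rw [Finset.sum_comm]
    refine Fintype.sum_equiv (Equiv.inv G) _ _ fun h => ?_
    refine Fintype.sum_equiv (MulAut.conj h⁻¹).toEquiv _ _ fun g => ?_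
    have := hop g (h⁻¹ * g * h) h⁻¹
    simp only [inv_inv] at this
    simp [this, mul_assoc]
  | dual s₀ s₁ e hv he =>
    have hne : e.left ≠ e.right := by
      rcases e with ⟨⟨a, b⟩, d⟩; fin_cases d <;> simp [Edge.left, Edge.right]
    have hop : ∀ g : G, dualOp s₁ e g = star (dualOp s₀ e g) := by
      intro g
      rcases he with ⟨h0, h1⟩ | ⟨h0, h1⟩ <;> unfold dualOp <;>
        simp only [h0, h1, hne, if_true, if_false, hv] <;> split_ifs <;>
        simp [star_edgeL, star_edgeR]
    rw [Triangle.opp, triangleMultiplet_dual, triangleMultiplet_dual, Matrix.conjTranspose_sum]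
    refine Finset.sum_congr rfl fun g _ => ?_
    rw [conjTranspose_scalar_mul_constMat, map_of_conjTranspose, hop]
    simp

/-- Both kinds of triangle give controlled unitaries. For a direct triangle the projections `T^h` on
the edge form a partition of unity and control the unitaries `D(∑_g (g, h))`. For a dual triangle
the projections `D(g, 1)` form a partition of unity and control the unitaries `L_τ^g`. -/
theorem triangleMultiplet_mul_conjTranspose (τ : Triangle) :
    triangleMultiplet D τ * (triangleMultiplet D τ)ᴴ = 1 := by
  cases τ with
  | direct s₀ s₁ e hf he =>
    have key : ∃ T : G → quasiLocal G, (∀ g h, triangleOp (.direct s₀ s₁ e hf he) g h = T h) ∧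
        (∀ g h, T g * star (T h) = if g = h then T g else 0) ∧ ∑ h, T h = 1 := by
      refine ⟨fun h => if s₀.vertex = e.source then edgeT e h else edgeT e h⁻¹,
        fun g h => rfl, fun g h => ?_, ?_⟩
      · split_ifs with h1 h2 h2 <;> simp [star_edgeT, edgeT_mul, h2]
      · split_ifs
        · exact sum_edgeT e
        · rw [← sum_edgeT e]
          exact Fintype.sum_equiv (Equiv.inv G) _ _ fun _ => rfl
    obtain ⟨T, hT, hTT, hT1⟩ := key
    have hM : triangleMultiplet D (.direct s₀ s₁ e hf he) = ∑ h, Matrix.scalar (Fin n) (T h) *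
        constMat G n (D (∑ g, QuantumDouble.of g h)) := by
      simp only [triangleMultiplet, hT, map_sum, Finset.mul_sum]
      rw [Finset.sum_comm]
    have hu : ∀ h : G, D (∑ g, QuantumDouble.of g h) * (D (∑ g, QuantumDouble.of g h))ᴴ = 1 := by
      intro h
      have hs : star (∑ g, QuantumDouble.of g h) = ∑ g, QuantumDouble.of g h⁻¹ := by
        rw [star_sum]
        refine Fintype.sum_equiv (MulAut.conj h⁻¹).toEquiv _ _ fun g => ?_
        simp [QuantumDouble.star_of]
      rw [← Matrix.star_eq_conjTranspose, ← map_star, ← map_mul, hs, Finset.sum_mul]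
      have : ∀ g : G, QuantumDouble.of g h * ∑ g', QuantumDouble.of g' h⁻¹
          = QuantumDouble.of g 1 := by
        intro g
        rw [Finset.mul_sum, Finset.sum_eq_single (h⁻¹ * g * h)]
        · rw [QuantumDouble.of_mul_of, if_pos (by group), mul_inv_cancel]
        · intro g' _ hg'
          rw [QuantumDouble.of_mul_of, if_neg]
          rintro rfl
          exact hg' (by group)
        · simp
      simp only [this, sum_of_one, map_one]
    rw [hM, Matrix.conjTranspose_sum, Finset.sum_mul]
    simp only [conjTranspose_scalar_mul_constMat, Finset.mul_sum, scalar_mul_constMat_mul, hTT]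
    have : ∀ x : G, ∑ h, Matrix.scalar (Fin n) (if x = h then T x else 0) * constMat G n
        (D (∑ g, QuantumDouble.of g x) * (D (∑ g, QuantumDouble.of g h))ᴴ)
          = Matrix.scalar (Fin n) (T x) := by
      intro x
      rw [Finset.sum_eq_single x]
      · rw [if_pos rfl, hu, map_one, mul_one]
      · intro h _ hh; simp [hh.symm]
      · simp
    simp only [map_sum, Finset.mul_sum, Finset.sum_mul] at this ⊢
    simp only [this]
    rw [← map_sum, hT1, map_one]
  | dual s₀ s₁ e hv he =>
    rw [triangleMultiplet_dual, Matrix.conjTranspose_sum, Finset.sum_mul]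
    simp only [conjTranspose_scalar_mul_constMat, Finset.mul_sum, scalar_mul_constMat_mul,
      map_of_conjTranspose, ← map_mul D, QuantumDouble.of_mul_of]
    have : ∀ x : G, ∑ g, Matrix.scalar (Fin n) (dualOp s₀ e x * star (dualOp s₀ e g)) *
        constMat G n (D (if x = 1 * (1⁻¹ * g * 1) * 1⁻¹ then QuantumDouble.of x (1 * 1⁻¹) else 0))
          = constMat G n (D (QuantumDouble.of x 1)) := by
      intro x
      rw [Finset.sum_eq_single x]
      · simp [(dualOp_mem_unitary s₀ e x).2]
      · intro h _ hh; simp [hh.symm]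
      · simp
    simp only [this]
    rw [← map_sum, ← map_sum, sum_of_one, map_one, map_one]

theorem Triangle.opp_opp (τ : Triangle) : τ.opp.opp = τ := by
  cases τ <;> rfl

theorem conjTranspose_triangleMultiplet_mul (τ : Triangle) :
    (triangleMultiplet D τ)ᴴ * triangleMultiplet D τ = 1 := by
  have := triangleMultiplet_mul_conjTranspose D τ.opp
  rwa [triangleMultiplet_opp, Matrix.conjTranspose_conjTranspose] at this

theorem ribbonMultiplet_mem_unitary (ρ : List Triangle) :
    ribbonMultiplet D ρ ∈ unitary (Matrix (Fin n) (Fin n) (quasiLocal G)) := by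
  induction ρ with
  | nil => rw [ribbonMultiplet_nil]; exact one_mem _
  | cons τ ρ ih =>
    rw [ribbonMultiplet_cons]
    exact mul_mem ⟨conjTranspose_triangleMultiplet_mul D τ, triangleMultiplet_mul_conjTranspose D τ⟩
      ih

theorem ribbonMultiplet_singleton (τ : Triangle) :
    ribbonMultiplet D [τ] = triangleMultiplet D τ := by
  rw [ribbonMultiplet_cons, ribbonMultiplet_nil, mul_one]

theorem ribbonMultiplet_oppRibbon (ρ : List Triangle) :
    ribbonMultiplet D (oppRibbon ρ) = (ribbonMultiplet D ρ)ᴴ := by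
  induction ρ with
  | nil => simp [oppRibbon]
  | cons τ ρ ih =>
    have : oppRibbon (τ :: ρ) = oppRibbon ρ ++ [τ.opp] := by simp [oppRibbon]
    rw [this, ribbonMultiplet_append, ih, ribbonMultiplet_singleton, triangleMultiplet_opp,
      ribbonMultiplet_cons, Matrix.conjTranspose_mul]

end Multiplets

/-! ## Local observables and limits -/

theorem cauchySeq_of_dense {E F : Type*} [SeminormedAddCommGroup E] [SeminormedAddCommGroup F]
    {f : ℕ → E → F} {C : ℝ} (hC : ∀ m x y, ‖f m x - f m y‖ ≤ C * ‖x - y‖) {S : Set E}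
    (hS : Dense S) (h : ∀ x ∈ S, CauchySeq fun m => f m x) (x : E) : CauchySeq fun m => f m x := by
  rw [Metric.cauchySeq_iff]
  intro ε hε
  -- No sign of `C` is assumed; `|C| + 1` is a positive number to divide by.
  have hC' : 0 < |C| + 1 := by positivity
  obtain ⟨y, hy, hxy⟩ := Metric.mem_closure_iff.1 (hS x) (ε / (4 * (|C| + 1))) (by positivity)
  obtain ⟨N, hN⟩ := Metric.cauchySeq_iff.1 (h y hy) (ε / 4) (by positivity)
  have hb : ∀ m, dist (f m x) (f m y) ≤ ε / 4 := by
    intro m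
    rw [dist_eq_norm]
    rw [dist_eq_norm] at hxy
    calc ‖f m x - f m y‖ ≤ C * ‖x - y‖ := hC m x y
      _ ≤ (|C| + 1) * (ε / (4 * (|C| + 1))) := by
          refine mul_le_mul ?_ hxy.le (norm_nonneg _) hC'.le
          linarith [le_abs_self C]
      _ = ε / 4 := by field_simp
  refine ⟨N, fun m hm k hk => ?_⟩
  have h1 := hb m
  have h2 := hb k
  rw [dist_comm] at h2
  linarith [hN m hm k hk, dist_triangle4 (f m x) (f m y) (f k y) (f k x)]

/-- Each `T_k T_k*` is positive and bounded by the sum. Applied to a row of a unitary matrix over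
`𝒜`, this bounds the entries, which is all that is needed since convergence of matrices is
entrywise. -/
theorem norm_le_one_of_sum_mul_star {K ι : Type*} [NormedAddCommGroup K] [InnerProductSpace ℂ K]
    [CompleteSpace K] [Fintype ι] {T : ι → K →L[ℂ] K} (h : ∑ k, T k * star (T k) = 1) (k : ι) :
    ‖T k‖ ≤ 1 := by
  rw [← norm_star]
  refine ContinuousLinearMap.opNorm_le_bound _ zero_le_one fun ψ => ?_
  have hk : ∀ l, ⟪ψ, (T l * star (T l)) ψ⟫_ℂ = ((‖star (T l) ψ‖ ^ 2 : ℝ) : ℂ) := by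
    intro l
    have : (T l * star (T l)) ψ = T l (star (T l) ψ) := rfl
    rw [this, ← ContinuousLinearMap.adjoint_inner_left, ← ContinuousLinearMap.star_eq_adjoint,
      inner_self_eq_norm_sq_to_K]
    norm_cast
  have hsum : ∑ l, ‖star (T l) ψ‖ ^ 2 = ‖ψ‖ ^ 2 := by
    have h1 : ⟪ψ, (∑ l, T l * star (T l)) ψ⟫_ℂ = ((‖ψ‖ ^ 2 : ℝ) : ℂ) := by
      rw [h, one_apply_eq_self, inner_self_eq_norm_sq_to_K]; norm_cast
    rw [sum_apply, inner_sum] at h1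
    simp only [hk] at h1
    exact_mod_cast h1
  have := Finset.single_le_sum (f := fun l => ‖star (T l) ψ‖ ^ 2) (fun l _ => by positivity)
    (Finset.mem_univ k)
  rw [one_mul]
  simp only [hsum] at this
  exact (sq_le_sq₀ (norm_nonneg _) (norm_nonneg _)).1 this

section Local

variable {G : Type*} [Group G] [DecidableEq G]

theorem localAlgebra_isClosed (X : Set Edge) :
    IsClosed (localAlgebra G X : Set (RefSpace G →L[ℂ] RefSpace G)) :=
  StarSubalgebra.isClosed_topologicalClosure _

theorem quasiLocal_completeSpace : CompleteSpace (quasiLocal G) :=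
  (localAlgebra_isClosed (G := G) Set.univ).completeSpace_coe

theorem norm_map_le {H : Type*} [NormedAddCommGroup H] [InnerProductSpace ℂ H] [CompleteSpace H]
    (π : quasiLocal G →⋆ₐ[ℂ] (H →L[ℂ] H)) (a : quasiLocal G) : ‖π a‖ ≤ ‖a‖ := by
  have := localAlgebra_isClosed (G := G) Set.univ
  exact NonUnitalStarAlgHom.norm_apply_le π a

theorem continuous_rep {H : Type*} [NormedAddCommGroup H] [InnerProductSpace ℂ H] [CompleteSpace H]
    (π : quasiLocal G →⋆ₐ[ℂ] (H →L[ℂ] H)) : Continuous π :=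
  AddMonoidHomClass.continuous_of_bound π 1 fun a => by rw [one_mul]; exact norm_map_le π a

variable (G) in
/-- The observables commuting with the observables of all but finitely many edges. -/
def localObs : Subalgebra ℂ (quasiLocal G) where
  carrier := {a | ∃ E : Finset Edge, ∀ e ∉ E, ∀ g h, Commute a (matUnit e g h)}
  mul_mem' := by
    classical
    rintro a b ⟨E, hE⟩ ⟨E', hE'⟩
    refine ⟨E ∪ E', fun e he g h => ?_⟩
    rw [Finset.mem_union, not_or] at he
    exact (hE e he.1 g h).mul_left (hE' e he.2 g h)
  add_mem' := by
    classical
    rintro a b ⟨E, hE⟩ ⟨E', hE'⟩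
    refine ⟨E ∪ E', fun e he g h => ?_⟩
    rw [Finset.mem_union, not_or] at he
    exact (hE e he.1 g h).add_left (hE' e he.2 g h)
  algebraMap_mem' z := ⟨∅, fun e _ g h => Algebra.commutes z _⟩

theorem star_mem_localObs {a : quasiLocal G} (ha : a ∈ localObs G) : star a ∈ localObs G := by
  obtain ⟨E, hE⟩ := ha
  refine ⟨E, fun e he g h => ?_⟩
  have := congrArg star (hE e he h g).eq
  rw [star_mul, star_mul, star_matUnit] at this
  exact this.symm

theorem matUnit_mem_localObs (e : Edge) (g h : G) : matUnit e g h ∈ localObs G :=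
  ⟨{e}, fun _ he' g' h' => commute_matUnit (fun hee => he' (by simp [hee])) g h g' h'⟩

/-- The generators are local and locality survives the algebra operations and the adjoint, so the
algebraic span, whose closure is `𝒜`, consists of local observables. -/
theorem dense_localObs : Dense (localObs G : Set (quasiLocal G)) := by
  have hadj : ∀ T ∈ StarAlgebra.adjoin ℂ {T | ∃ e ∈ (Set.univ : Set Edge), ∃ g h : G,
      T = matUnitOp e g h}, ∃ a ∈ localObs G, (a : RefSpace G →L[ℂ] RefSpace G) = T := by
    intro T hT
    induction hT using StarAlgebra.adjoin_induction with
    | mem T hT =>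
      obtain ⟨e, _, g, h, rfl⟩ := hT
      exact ⟨matUnit e g h, matUnit_mem_localObs e g h, rfl⟩
    | algebraMap z => exact ⟨algebraMap ℂ _ z, Subalgebra.algebraMap_mem _ z, rfl⟩
    | add S T _ _ hS hT =>
      obtain ⟨a, ha, rfl⟩ := hS
      obtain ⟨b, hb, rfl⟩ := hT
      exact ⟨a + b, add_mem ha hb, rfl⟩
    | mul S T _ _ hS hT =>
      obtain ⟨a, ha, rfl⟩ := hS
      obtain ⟨b, hb, rfl⟩ := hT
      exact ⟨a * b, mul_mem ha hb, rfl⟩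
    | star S _ hS =>
      obtain ⟨a, ha, rfl⟩ := hS
      exact ⟨star a, star_mem_localObs ha, rfl⟩
  intro a
  rw [Metric.mem_closure_iff]
  intro ε hε
  obtain ⟨T, hT, hd⟩ := Metric.mem_closure_iff.1 a.2 ε hε
  obtain ⟨b, hb, rfl⟩ := hadj T hT
  exact ⟨b, hb, hd⟩

/-! ### Support of ribbon operators -/

variable [Fintype G]

theorem triangleOp_mem {C : Subalgebra ℂ (quasiLocal G)} {τ : Triangle}
    (hC : ∀ g h, matUnit τ.edge g h ∈ C) (g h : G) : triangleOp τ g h ∈ C := by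
  cases τ with
  | direct s₀ s₁ e hf he =>
    simp only [triangleOp]
    split_ifs <;> exact hC _ _
  | dual s₀ s₁ e hv he =>
    simp only [triangleOp]
    split_ifs
    · exact sum_mem fun _ _ => hC _ _
    · exact sum_mem fun _ _ => hC _ _
    · exact sum_mem fun _ _ => hC _ _
    · exact sum_mem fun _ _ => hC _ _
    · exact zero_mem _

/-- The subalgebra is arbitrary in order to cover two uses: with a centralizer it gives commutation
with distant observables, with a local algebra it gives the support in the cone. -/
theorem ribbonOp_mem {C : Subalgebra ℂ (quasiLocal G)} {ρ : List Triangle}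
    (hC : ∀ τ ∈ ρ, ∀ g h, matUnit τ.edge g h ∈ C) (g h : G) : ribbonOp ρ g h ∈ C := by
  induction ρ generalizing g h with
  | nil =>
    simp only [ribbonOp]
    split_ifs
    exacts [one_mem _, zero_mem _]
  | cons τ ρ ih =>
    exact sum_mem fun k _ => mul_mem (triangleOp_mem (hC τ (by simp)) _ _)
      (ih (fun τ' h' => hC τ' (by simp [h'])) _ _)

variable {n : ℕ} (D : QuantumDouble G →⋆ₐ[ℂ] Matrix (Fin n) (Fin n) ℂ)

theorem ribbonMultiplet_mem {C : Subalgebra ℂ (quasiLocal G)} {ρ : List Triangle}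
    (hC : ∀ τ ∈ ρ, ∀ g h, matUnit τ.edge g h ∈ C) (i j : Fin n) : ribbonMultiplet D ρ i j ∈ C :=
  sum_mem fun _ _ => sum_mem fun _ _ => C.smul_mem (ribbonOp_mem hC _ _) _

theorem commute_ribbonMultiplet {a : quasiLocal G} {ρ : List Triangle}
    (ha : ∀ τ ∈ ρ, ∀ g h, Commute a (matUnit τ.edge g h)) (i j : Fin n) :
    Commute a (ribbonMultiplet D ρ i j) := by
  have := ribbonMultiplet_mem D (C := Subalgebra.centralizer ℂ {a}) (ρ := ρ)
    (fun τ hτ g h => by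
      rw [Subalgebra.mem_centralizer_iff]
      rintro _ rfl
      exact ha τ hτ g h) i j
  rw [Subalgebra.mem_centralizer_iff] at this
  exact this a rfl

theorem commute_diagonal_ribbonMultiplet {a : quasiLocal G} {ρ : List Triangle}
    (ha : ∀ τ ∈ ρ, ∀ g h, Commute a (matUnit τ.edge g h)) :
    Commute (Matrix.diagonal fun _ => a) (ribbonMultiplet D ρ) := by
  ext i j : 1
  rw [Matrix.diagonal_mul, Matrix.mul_diagonal]
  exact commute_ribbonMultiplet D ha i j

theorem ribbonMultiplet_mem_localAlgebra {X : Set Edge} {ρ : List Triangle}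
    (hρ : ∀ τ ∈ ρ, τ.edge ∈ X) (i j : Fin n) :
    (ribbonMultiplet D ρ i j : RefSpace G →L[ℂ] RefSpace G) ∈ localAlgebra G X :=
  ribbonMultiplet_mem D
    (C := (localAlgebra G X).toSubalgebra.comap (quasiLocal G).subtype.toAlgHom)
    (fun τ hτ g h => StarSubalgebra.le_topologicalClosure _
      (StarAlgebra.subset_adjoin ℂ _ ⟨τ.edge, hρ τ hτ, g, h, rfl⟩)) i j

theorem norm_unitary_entry_le {U : Matrix (Fin n) (Fin n) (quasiLocal G)}
    (hU : U ∈ unitary (Matrix (Fin n) (Fin n) (quasiLocal G))) (i j : Fin n) : ‖U i j‖ ≤ 1 := by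
  have h1 : U * Uᴴ = 1 := hU.2
  have h2 : ∑ k, U i k * star (U i k) = 1 := by
    have := congrFun (congrFun h1 i) i
    rwa [Matrix.mul_apply, Matrix.one_apply_eq] at this
  have h3 : ∑ k, (U i k : RefSpace G →L[ℂ] RefSpace G) *
      star (U i k : RefSpace G →L[ℂ] RefSpace G) = 1 := by
    have := congrArg (fun a : quasiLocal G => (a : RefSpace G →L[ℂ] RefSpace G)) h2
    simp only [AddSubmonoidClass.coe_finsetSum] at this
    exact this
  exact norm_le_one_of_sum_mul_star h3 j

theorem norm_ribbonMultiplet_le (ρ : List Triangle) (i j : Fin n) :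
    ‖ribbonMultiplet D ρ i j‖ ≤ 1 :=
  norm_unitary_entry_le (ribbonMultiplet_mem_unitary D ρ) i j

/-! ### Convergence of the amplimorphisms -/

theorem finiteAmpli_apply (ρ : List Triangle) (O : quasiLocal G) (i j : Fin n) :
    finiteAmpli D ρ O i j =
      ∑ k, ribbonMultiplet D ρ i k * O * star (ribbonMultiplet D ρ j k) := by
  rw [finiteAmpli, Matrix.mul_apply]
  refine Finset.sum_congr rfl fun k _ => ?_
  rw [Matrix.mul_diagonal, Matrix.conjTranspose_apply]

theorem norm_finiteAmpli_sub_le (ρ : List Triangle) (O O' : quasiLocal G) (i j : Fin n) :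
    ‖finiteAmpli D ρ O i j - finiteAmpli D ρ O' i j‖ ≤ n * ‖O - O'‖ := by
  rw [finiteAmpli_apply, finiteAmpli_apply, ← Finset.sum_sub_distrib]
  refine (norm_sum_le _ _).trans ?_
  have : ∀ k ∈ Finset.univ, ‖ribbonMultiplet D ρ i k * O * star (ribbonMultiplet D ρ j k) -
      ribbonMultiplet D ρ i k * O' * star (ribbonMultiplet D ρ j k)‖ ≤ ‖O - O'‖ := by
    intro k _
    rw [← sub_mul, ← mul_sub]
    calc _ ≤ ‖ribbonMultiplet D ρ i k * (O - O')‖ * ‖star (ribbonMultiplet D ρ j k)‖ :=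
          norm_mul_le _ _
      _ ≤ (‖ribbonMultiplet D ρ i k‖ * ‖O - O'‖) * 1 := by
          refine mul_le_mul (norm_mul_le _ _) ?_ (norm_nonneg _) (by positivity)
          exact (norm_star (ribbonMultiplet D ρ j k)).le.trans (norm_ribbonMultiplet_le D ρ j k)
      _ ≤ 1 * ‖O - O'‖ := by
          rw [mul_one]
          exact mul_le_mul_of_nonneg_right (norm_ribbonMultiplet_le D ρ i k) (norm_nonneg _)
      _ = ‖O - O'‖ := one_mul _
  refine (Finset.sum_le_sum this).trans ?_
  simp

namespace HalfInfiniteRibbon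

/-- The triangles of a half-infinite ribbon from number `K` up to number `m`. -/
def segment (ρ : HalfInfiniteRibbon) (K m : ℕ) : List Triangle := (List.range' K (m - K)).map ρ.tri

theorem initial_eq_append (ρ : HalfInfiniteRibbon) {K m : ℕ} (h : K ≤ m) :
    ρ.initial m = ρ.initial K ++ ρ.segment K m := by
  rw [initial, initial, segment, ← List.map_append, List.range_eq_range', List.range_eq_range']
  congr 1
  have := List.range'_append (s := 0) (m := K) (n := m - K) (step := 1)
  simp only [one_mul, zero_add] at this
  rw [this]
  congr 1; omega

theorem mem_segment {ρ : HalfInfiniteRibbon} {K m : ℕ} {τ : Triangle} (h : τ ∈ ρ.segment K m) :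
    ∃ k, K ≤ k ∧ k < m ∧ ρ.tri k = τ := by
  simp only [segment, List.mem_map, List.mem_range'_1] at h
  obtain ⟨k, ⟨h1, h2⟩, h3⟩ := h
  exact ⟨k, h1, by omega, h3⟩

theorem eventually_edge_notMem (ρ : HalfInfiniteRibbon) {E : Set Edge} (hE : E.Finite) :
    ∃ K, ∀ k ≥ K, (ρ.tri k).edge ∉ E := by
  have : {k | (ρ.tri k).edge ∈ E}.Finite := hE.preimage ρ.edge_injective.injOn
  obtain ⟨b, hb⟩ := this.bddAbove
  exact ⟨b + 1, fun k hk hmem => by have := hb hmem; omega⟩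

end HalfInfiniteRibbon

/-- The unitary `F(ρ')` passes through `O ⊗ 1` and cancels against its adjoint. -/
theorem finiteAmpli_append {ρ ρ' : List Triangle} {O : quasiLocal G}
    (h : ∀ τ ∈ ρ', ∀ g h, Commute O (matUnit τ.edge g h)) :
    finiteAmpli D (ρ ++ ρ') O = finiteAmpli D ρ O := by
  have h1 : ribbonMultiplet D ρ' * (ribbonMultiplet D ρ')ᴴ = 1 :=
    (ribbonMultiplet_mem_unitary D ρ').2
  have h2 := (commute_diagonal_ribbonMultiplet D h).eq
  rw [finiteAmpli, ribbonMultiplet_append, Matrix.conjTranspose_mul, mul_assoc (ribbonMultiplet D ρ),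
    ← h2, mul_assoc, mul_assoc, ← mul_assoc (ribbonMultiplet D ρ'), h1, one_mul, finiteAmpli,
    mul_assoc]

theorem finiteAmpli_eventually_const (ρ : HalfInfiniteRibbon) {O : quasiLocal G}
    (hO : O ∈ localObs G) :
    ∃ K, ∀ m ≥ K, finiteAmpli D (ρ.initial m) O = finiteAmpli D (ρ.initial K) O := by
  obtain ⟨E, hE⟩ := hO
  obtain ⟨K, hK⟩ := ρ.eventually_edge_notMem E.finite_toSet
  refine ⟨K, fun m hm => ?_⟩
  rw [ρ.initial_eq_append hm]
  refine finiteAmpli_append D fun τ hτ => ?_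
  obtain ⟨k, hk, _, rfl⟩ := HalfInfiniteRibbon.mem_segment hτ
  exact hE _ (hK k hk)

/-- On local observables the sequence is eventually constant. The bound `norm_finiteAmpli_sub_le`,
uniform in `m`, extends the Cauchy property to all of `𝒜`. -/
theorem tendsto_finiteAmpli (ρ : HalfInfiniteRibbon) (O : quasiLocal G) :
    Tendsto (fun m => finiteAmpli D (ρ.initial m) O) atTop (𝓝 (ampli D ρ O)) := by
  have hc : ∀ i j, CauchySeq fun m => finiteAmpli D (ρ.initial m) O i j := by
    intro i j
    refine cauchySeq_of_dense (f := fun m O => finiteAmpli D (ρ.initial m) O i j)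
      (fun m x y => norm_finiteAmpli_sub_le D (ρ.initial m) x y i j) dense_localObs
      (fun x hx => ?_) O
    obtain ⟨K, hK⟩ := finiteAmpli_eventually_const D ρ hx
    exact (tendsto_atTop_of_eventually_const (i₀ := K) fun m hm => by rw [hK m hm]).cauchySeq
  have := quasiLocal_completeSpace (G := G)
  choose L hL using fun i j => cauchySeq_tendsto_of_complete (hc i j)
  exact tendsto_nhds_limUnder
    ⟨Matrix.of L, tendsto_pi_nhds.2 fun i => tendsto_pi_nhds.2 fun j => hL i j⟩

end Local

/-! ## Crossings of dual edges and winding functions -/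

/-- `s, ρ, s'` form a path: the triangles of `ρ` fit together and lead from `s` to `s'`. -/
def IsPath : Site → List Triangle → Site → Prop
  | s, [], s' => s = s'
  | s, τ :: ρ, s' => τ.first = s ∧ IsPath τ.final ρ s'

theorem isPath_of_isChain {τ τ' : Triangle} {ρ : List Triangle}
    (h : (τ :: (ρ ++ [τ'])).IsChain fun τ τ' => τ.final = τ'.first) :
    IsPath τ.first (τ :: (ρ ++ [τ'])) τ'.final := by
  induction ρ generalizing τ with
  | nil =>
    simp only [List.nil_append, List.isChain_cons_cons] at h
    exact ⟨rfl, h.1.symm, rfl⟩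
  | cons τ'' ρ ih =>
    simp only [List.cons_append, List.isChain_cons_cons] at h
    refine ⟨rfl, ?_⟩
    rw [h.1]
    exact ih h.2

/-- The signed crossing of an edge by the dual edge of a triangle; crossings from right to left
count as positive. -/
noncomputable def crossing : Triangle → Edge →₀ ℤ
  | .direct _ _ _ _ _ => 0
  | .dual s₀ _ e _ _ => Finsupp.single e (if s₀.face = e.right then 1 else -1)

/-- The signed crossings of edges by the dual edges of a list of triangles. -/
noncomputable def crossings (ρ : List Triangle) : Edge →₀ ℤ := (ρ.map crossing).sum

@[simp] theorem crossings_nil : crossings [] = 0 := rfl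

@[simp] theorem crossings_cons (τ : Triangle) (ρ : List Triangle) :
    crossings (τ :: ρ) = crossing τ + crossings ρ := by simp [crossings]

theorem crossings_append (ρ ρ' : List Triangle) :
    crossings (ρ ++ ρ') = crossings ρ + crossings ρ' := by simp [crossings]

theorem crossing_apply_eq_zero {τ : Triangle} {e : Edge} (h : τ.edge ≠ e) : crossing τ e = 0 := by
  cases τ with
  | direct => rfl
  | dual s₀ s₁ e' hv he => exact Finsupp.single_eq_of_ne (Ne.symm h)

theorem crossings_apply_eq_zero {ρ : List Triangle} {e : Edge} (h : ∀ τ ∈ ρ, τ.edge ≠ e) :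
    crossings ρ e = 0 := by
  induction ρ with
  | nil => rfl
  | cons τ ρ ih =>
    rw [crossings_cons, Finsupp.add_apply, crossing_apply_eq_zero (h τ (by simp)),
      ih fun τ' h' => h τ' (by simp [h']), add_zero]

/-- The signed number of crossings into a face. -/
def influx (n : Edge →₀ ℤ) : Face → ℤ
  | .up a b => n ⟨(a, b), 0⟩ - n ⟨(a, b), 1⟩ - n ⟨(a, b + 1), 2⟩
  | .down a b => n ⟨(a + 1, b), 1⟩ + n ⟨(a, b + 1), 2⟩ - n ⟨(a, b + 1), 0⟩

theorem influx_add (n n' : Edge →₀ ℤ) (f : Face) : influx (n + n') f = influx n f + influx n' f := by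
  cases f <;> simp only [influx, Finsupp.add_apply] <;> ring

theorem influx_sub (n n' : Edge →₀ ℤ) (f : Face) : influx (n - n') f = influx n f - influx n' f := by
  cases f <;> simp only [influx, Finsupp.sub_apply] <;> ring

theorem influx_single (e : Edge) (z : ℤ) (f : Face) : influx (Finsupp.single e z) f =
    (if e.left = f then z else 0) - (if e.right = f then z else 0) := by
  rcases e with ⟨⟨x, y⟩, d⟩
  rcases f with ⟨a, b⟩ | ⟨a, b⟩ <;> fin_cases d <;>
    simp [influx, Finsupp.single_apply, Edge.left, Edge.right] <;> grind

theorem Edge.left_ne_right (e : Edge) : e.left ≠ e.right := by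
  rcases e with ⟨⟨a, b⟩, d⟩; fin_cases d <;> simp [Edge.left, Edge.right]

theorem Edge.source_ne_target (e : Edge) : e.source ≠ e.target := by
  rcases e with ⟨⟨a, b⟩, d⟩; fin_cases d <;> simp [Edge.target]

theorem influx_crossing (τ : Triangle) (f : Face) : influx (crossing τ) f =
    (if τ.final.face = f then 1 else 0) - (if τ.first.face = f then 1 else 0) := by
  cases τ with
  | direct s₀ s₁ e hf he =>
    have hff : (Triangle.direct s₀ s₁ e hf he).final.face = (Triangle.direct s₀ s₁ e hf he).first.face :=
      hf.symm
    rw [crossing, if_congr (by rw [hff]) rfl rfl, sub_self]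
    cases f <;> simp [influx]
  | dual s₀ s₁ e hv he =>
    simp only [crossing, Triangle.final, Triangle.first, influx_single]
    rcases he with ⟨h0, h1⟩ | ⟨h0, h1⟩
    · simp [h0, h1]
    · simp only [h0, h1, e.left_ne_right, if_false]
      split_ifs <;> simp

/-- The contributions telescope along the path. In particular, two paths with the same end sites
have crossings whose difference has no influx into any face. -/
theorem influx_crossings {s s' : Site} {ρ : List Triangle} (h : IsPath s ρ s') (f : Face) :
    influx (crossings ρ) f = (if s'.face = f then 1 else 0) - (if s.face = f then 1 else 0) := by
  induction ρ generalizing s with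
  | nil => cases h; cases f <;> simp [influx]
  | cons τ ρ ih => rw [crossings_cons, influx_add, influx_crossing, ih h.2, h.1]; ring

/-- `w` is a winding function for the crossings `n`: it jumps by `n` across each edge. -/
def IsWinding (n : Edge →₀ ℤ) (w : Vertex → ℤ) : Prop := ∀ e : Edge, w e.source - w e.target = n e

theorem exists_coordinate_bound (s : Finset Edge) :
    ∃ M : ℤ, 0 < M ∧ ∀ e ∈ s, |e.source.1| < M ∧ |e.source.2| < M := by
  refine ⟨1 + ∑ e ∈ s, (|e.source.1| + |e.source.2|), ?_, fun e he => ?_⟩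
  · have : 0 ≤ ∑ e ∈ s, (|e.source.1| + |e.source.2|) := Finset.sum_nonneg fun e _ => by positivity
    omega
  · have := Finset.single_le_sum (f := fun e : Edge => |e.source.1| + |e.source.2|)
      (fun e _ => by positivity) he
    have h1 := abs_nonneg e.source.1
    have h2 := abs_nonneg e.source.2
    constructor <;> linarith

/-- A discrete Poincaré lemma with finite support: vanishing influx says that `n` is closed around
every triangle, hence it is the difference of a function on the vertices, normalised to vanish far
away. -/
theorem exists_isWinding {n : Edge →₀ ℤ} (hn : ∀ f, influx n f = 0) :
    ∃ w : Vertex → ℤ, IsWinding n w ∧ ∃ M : ℤ, ∀ v : Vertex, M ≤ |v.1| ∨ M ≤ |v.2| → w v = 0 := by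
  obtain ⟨M, hM0, hM⟩ := exists_coordinate_bound n.support
  have hz : ∀ e : Edge, M ≤ |e.source.1| ∨ M ≤ |e.source.2| → n e = 0 := by
    intro e he
    by_contra h
    have := hM e (Finsupp.mem_support_iff.2 h)
    omega
  -- The winding at `v` counts the crossings of the horizontal half-line going to the right from
  -- `v`; beyond `M` there are none.
  set w : Vertex → ℤ := fun v => ∑ i ∈ Finset.Ico v.1 M, n ⟨(i, v.2), 0⟩ with hw
  have h0 : ∀ a b, w (a, b) - w (a + 1, b) = n ⟨(a, b), 0⟩ := by
    intro a b
    by_cases ha : a < M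
    · simp only [hw]
      have : Finset.Ico a M = insert a (Finset.Ico (a + 1) M) := by ext x; simp; omega
      rw [this, Finset.sum_insert (by simp)]; ring
    · simp only [hw]
      rw [Finset.Ico_eq_empty (by omega), Finset.Ico_eq_empty (by omega),
        hz ⟨(a, b), 0⟩ (Or.inl (by rw [le_abs]; left; simpa using ha))]
      simp
  have hup : ∀ a b, n ⟨(a, b), 0⟩ - n ⟨(a, b), 1⟩ - n ⟨(a, b + 1), 2⟩ = 0 := fun a b => hn (.up a b)
  have hdown : ∀ a b, n ⟨(a + 1, b), 1⟩ + n ⟨(a, b + 1), 2⟩ - n ⟨(a, b + 1), 0⟩ = 0 :=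
    fun a b => hn (.down a b)
  have hlarge : ∀ a b, M ≤ a → w (a, b) = 0 := fun a b ha => by
    simp only [hw]; rw [Finset.Ico_eq_empty (by omega)]; simp
  have h1 : ∀ a b, w (a, b) - w (a, b + 1) = n ⟨(a, b), 1⟩ := by
    -- Induction leftwards from the columns with `a ≥ M`, where everything vanishes. The two
    -- triangles between columns `a` and `a + 1` propagate the identity.
    have key : ∀ (k : ℕ) a b, M ≤ a + k → w (a, b) - w (a, b + 1) = n ⟨(a, b), 1⟩ := by
      intro k
      induction k with
      | zero =>
        intro a b ha
        have ha : M ≤ a := by simpa using ha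
        rw [hlarge _ _ ha, hlarge _ _ ha,
          hz ⟨(a, b), 1⟩ (Or.inl (by rw [le_abs]; left; simpa using ha))]
        simp
      | succ k ih =>
        intro a b ha
        have := ih (a + 1) b (by push_cast at ha; linarith)
        linarith [h0 a b, h0 a (b + 1), hup a b, hdown a b]
    intro a b
    exact key (M - a).toNat a b (by omega)
  refine ⟨w, ?_, M, ?_⟩
  · rintro ⟨⟨a, b⟩, d⟩
    fin_cases d
    · exact h0 a b
    · exact h1 a b
    · have e1 := h0 a (b - 1)
      have e2 := h1 a (b - 1)
      have e3 := hup a (b - 1)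
      simp only [sub_add_cancel] at e1 e2 e3
      simp only [Edge.target]
      show w (a, b) - w (a + 1, b - 1) = n ⟨(a, b), 2⟩
      linarith
  · have hb : ∀ a b, M ≤ |b| → w (a, b) = 0 := fun a b hb =>
      Finset.sum_eq_zero fun i _ => hz ⟨(i, b), 0⟩ (Or.inr hb)
    rintro ⟨a, b⟩ (h | h)
    · rcases le_abs.1 h with h' | h'
      · exact hlarge _ _ h'
      -- For `a ≤ -M` no edge of direction `1` in this column is crossed, so one can move up until
      -- `b ≥ M`, where the defining sum vanishes.
      · have key : ∀ (k : ℕ), w (a, b) = w (a, b + k) := by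
          intro k
          induction k with
          | zero => simp
          | succ k ih =>
            have := h1 a (b + k)
            rw [hz ⟨(a, b + k), 1⟩ (Or.inl h)] at this
            rw [ih]; push_cast; rw [← add_assoc]; linarith
        rw [key (M - b).toNat]
        refine hb _ _ ?_
        rw [le_abs]; left; omega
    · exact hb _ _ h

/-! ## Leaving a cone -/

/-- The point of the plane with given lattice coordinates. -/
noncomputable def latticePoint (x y : ℝ) : Plane := !₂[x + y / 2, √3 / 2 * y]

theorem norm_latticePoint_sq (x y : ℝ) : ‖latticePoint x y‖ ^ 2 = x ^ 2 + x * y + y ^ 2 := by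
  rw [EuclideanSpace.norm_sq_eq, Fin.sum_univ_two]
  simp only [latticePoint, Real.norm_eq_abs, sq_abs]
  have : √3 ^ 2 = (3 : ℝ) := Real.sq_sqrt (by norm_num)
  simp
  ring_nf
  rw [this]; ring

theorem norm_latticePoint_le (x y : ℝ) : ‖latticePoint x y‖ ≤ |x| + |y| := by
  refine (sq_le_sq₀ (norm_nonneg _) (by positivity)).1 ?_
  rw [norm_latticePoint_sq, add_sq, sq_abs, sq_abs]
  have : x * y ≤ |x| * |y| := by rw [← abs_mul]; exact le_abs_self _
  nlinarith [abs_nonneg x, abs_nonneg y, mul_nonneg (abs_nonneg x) (abs_nonneg y)]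

theorem abs_le_norm_latticePoint (x y : ℝ) :
    |x| ≤ 2 * ‖latticePoint x y‖ ∧ |y| ≤ 2 * ‖latticePoint x y‖ := by
  constructor <;> refine abs_le_of_sq_le_sq ?_ (by positivity) <;>
    (rw [mul_pow, norm_latticePoint_sq]; nlinarith [sq_nonneg (x + 2 * y), sq_nonneg (2 * x + y)])

theorem latticePoint_sub (x y x' y' : ℝ) :
    latticePoint x y - latticePoint x' y' = latticePoint (x - x') (y - y') := by
  ext i; fin_cases i <;> simp [latticePoint] <;> ring

theorem Edge.exists_mid_eq (e : Edge) : ∃ x y : ℝ, |x| ≤ 1 / 2 ∧ |y| ≤ 1 / 2 ∧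
    e.mid = latticePoint (e.source.1 + x) (e.source.2 + y) := by
  rcases e with ⟨⟨a, b⟩, d⟩
  have hhalf : |(1 / 2 : ℝ)| ≤ 1 / 2 := by rw [abs_of_pos (by norm_num)]
  have hhalf' : |(-(1 / 2) : ℝ)| ≤ 1 / 2 := by rw [abs_neg]; exact hhalf
  fin_cases d
  · refine ⟨1 / 2, 0, hhalf, by norm_num, ?_⟩
    ext i; fin_cases i <;>
      simp [latticePoint, Edge.mid, midpoint_eq_smul_add, Vertex.pos, Edge.target] <;> ring
  · refine ⟨0, 1 / 2, by norm_num, hhalf, ?_⟩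
    ext i; fin_cases i <;>
      simp [latticePoint, Edge.mid, midpoint_eq_smul_add, Vertex.pos, Edge.target] <;> ring
  · refine ⟨1 / 2, -(1 / 2), hhalf, hhalf', ?_⟩
    ext i; fin_cases i <;>
      simp [latticePoint, Edge.mid, midpoint_eq_smul_add, Vertex.pos, Edge.target] <;> ring

theorem edgesIn_ball_finite (x : Plane) (r : ℝ) : (edgesIn (Metric.ball x r)).Finite := by
  obtain ⟨N, hN⟩ := exists_nat_gt (2 * (‖x‖ + |r|) + 1)
  have hfin : ((fun p : (ℤ × ℤ) × Fin 3 => (⟨p.1, p.2⟩ : Edge)) ''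
      ((Set.Icc (-N : ℤ) N ×ˢ Set.Icc (-N : ℤ) N) ×ˢ Set.univ)).Finite :=
    (((Set.finite_Icc _ _).prod (Set.finite_Icc _ _)).prod Set.finite_univ).image _
  refine hfin.subset fun e he => ⟨(e.source, e.dir), ⟨?_, Set.mem_univ _⟩, rfl⟩
  obtain ⟨y, z, hy, hz, hmid⟩ := e.exists_mid_eq
  have hlt : ‖e.mid‖ < ‖x‖ + |r| := by
    have h1 : dist e.mid x < r := he
    rw [dist_eq_norm] at h1
    have h2 : ‖e.mid‖ ≤ ‖x‖ + ‖e.mid - x‖ := by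
      simpa using norm_add_le x (e.mid - x)
    linarith [le_abs_self r]
  rw [hmid] at hlt
  obtain ⟨h1, h2⟩ := abs_le_norm_latticePoint (e.source.1 + y) (e.source.2 + z)
  rw [abs_le] at h1 h2 hy hz
  simp only [Set.mem_prod, Set.mem_Icc]
  refine ⟨⟨?_, ?_⟩, ⟨?_, ?_⟩⟩ <;> rify <;> linarith

/-- Neighbouring lattice coordinates are joined by at most one edge of direction `0` followed by at
most one of direction `1`, and these edges start within distance one in each coordinate. -/
theorem eq_of_step {w : Vertex → ℤ} {i j i' j' : ℤ} (hi : |i' - i| ≤ 1) (hj : |j' - j| ≤ 1)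
    (h : ∀ x y d, |x - i| ≤ 1 → |y - j| ≤ 1 →
      w (Edge.source ⟨(x, y), d⟩) = w (Edge.target ⟨(x, y), d⟩)) :
    w (i, j) = w (i', j') := by
  have hx : w (i, j) = w (i', j) := by
    have h1 := h i j 0 (by simp) (by simp)
    have h2 := h (i - 1) j 0 (by simp) (by simp)
    simp only [Edge.target, Matrix.cons_val_zero, sub_add_cancel] at h1 h2
    rw [abs_le] at hi
    rcases (by omega : i' = i ∨ i' = i + 1 ∨ i' = i - 1) with rfl | rfl | rfl
    exacts [rfl, h1, h2.symm]
  rw [hx]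
  have h1 := h i' j 1 hi (by simp)
  have h2 := h i' (j - 1) 1 hi (by simp)
  simp only [Edge.target, Matrix.cons_val_one, Matrix.cons_val_zero, sub_add_cancel] at h1 h2
  rw [abs_le] at hj
  rcases (by omega : j' = j ∨ j' = j + 1 ∨ j' = j - 1) with rfl | rfl | rfl
  exacts [rfl, h1, h2.symm]

theorem abs_floor_sub_floor_le {x y : ℝ} (h : |x - y| ≤ 1) : |⌊x⌋ - ⌊y⌋| ≤ 1 := by
  rw [abs_le] at h ⊢
  have h1 := Int.floor_le x
  have h2 := Int.lt_floor_add_one x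
  have h3 := Int.floor_le y
  have h4 := Int.lt_floor_add_one y
  have h5 : (⌊x⌋ : ℝ) - ⌊y⌋ < 2 := by linarith
  have h6 : (-2 : ℝ) < (⌊x⌋ : ℝ) - ⌊y⌋ := by linarith
  have h5' : ⌊x⌋ - ⌊y⌋ < 2 := by exact_mod_cast h5
  have h6' : -2 < ⌊x⌋ - ⌊y⌋ := by exact_mod_cast h6
  constructor <;> omega

/-- A function on the vertices that vanishes far away and does not change along the edges whose
midpoints are close to a ray vanishes at the vertex at which the ray starts. -/
theorem eq_zero_of_const_along_ray {w : Vertex → ℤ} {M : ℤ}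
    (hM : ∀ v : Vertex, M ≤ |v.1| ∨ M ≤ |v.2| → w v = 0) (v₀ : Vertex) {u : Plane} (hu : ‖u‖ = 1)
    (h : ∀ (t : ℕ) (e : Edge), ‖e.mid - (Vertex.pos v₀ + ((t : ℝ) / 2) • u)‖ ≤ 5 →
      w e.source = w e.target) : w v₀ = 0 := by
  obtain ⟨a, b⟩ := v₀
  have hs3 : (0 : ℝ) < √3 := Real.sqrt_pos.2 (by norm_num)
  have hs1 : (1 : ℝ) ≤ √3 := Real.one_le_sqrt.2 (by norm_num)
  -- The ray is sampled at steps of length `1/2`: then both lattice coordinates of a step are at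
  -- most `1` in absolute value, and their integer parts change by at most one.
  obtain ⟨α, β, hαβ⟩ : ∃ α β : ℝ, (1 / 2 : ℝ) • u = latticePoint α β := by
    refine ⟨u 0 / 2 - u 1 / √3 / 2, u 1 / √3, ?_⟩
    ext i; fin_cases i
    · simp [latticePoint]; ring
    · simp [latticePoint]; field_simp
  have hhalf : ‖latticePoint α β‖ = 1 / 2 := by rw [← hαβ, norm_smul, hu]; norm_num
  obtain ⟨hα, hβ⟩ := abs_le_norm_latticePoint α β
  rw [hhalf] at hα hβ
  norm_num at hα hβ
  set r : ℕ → Vertex := fun t => (a + ⌊(t : ℝ) * α⌋, b + ⌊(t : ℝ) * β⌋) with hr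
  have hp : ∀ t : ℕ, Vertex.pos (a, b) + ((t : ℝ) / 2) • u
      = latticePoint (a + t * α) (b + t * β) := by
    intro t
    have : ((t : ℝ) / 2) • u = (t : ℝ) • latticePoint α β := by
      rw [← hαβ, smul_smul]; congr 1; ring
    rw [this]
    ext i; fin_cases i <;> simp [latticePoint, Vertex.pos] <;> ring
  have hstep : ∀ t, w (r t) = w (r (t + 1)) := by
    intro t
    refine eq_of_step ?_ ?_ ?_
    · have := abs_floor_sub_floor_le (x := ((t + 1 : ℕ) : ℝ) * α) (y := (t : ℝ) * α)
        (by push_cast; ring_nf; exact hα)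
      simpa using this
    · have := abs_floor_sub_floor_le (x := ((t + 1 : ℕ) : ℝ) * β) (y := (t : ℝ) * β)
        (by push_cast; ring_nf; exact hβ)
      simpa using this
    · intro x y d hx hy
      refine h t ⟨(x, y), d⟩ ?_
      obtain ⟨x', y', hx', hy', hmid⟩ := Edge.exists_mid_eq ⟨(x, y), d⟩
      rw [hmid, hp, latticePoint_sub]
      refine (norm_latticePoint_le _ _).trans ?_
      have hx2 : |(x : ℝ) - (a + ⌊(t : ℝ) * α⌋ : ℤ)| ≤ 1 := by exact_mod_cast hx
      have hy2 : |(y : ℝ) - (b + ⌊(t : ℝ) * β⌋ : ℤ)| ≤ 1 := by exact_mod_cast hy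
      push_cast at hx2 hy2
      have f1 := Int.floor_le ((t : ℝ) * α)
      have f2 := Int.lt_floor_add_one ((t : ℝ) * α)
      have f3 := Int.floor_le ((t : ℝ) * β)
      have f4 := Int.lt_floor_add_one ((t : ℝ) * β)
      rw [abs_le] at hx2 hy2 hx' hy'
      -- Rounding down costs `1`, the auxiliary lattice step `1`, the midpoint `1/2`. Two
      -- coordinates with this error give the radius `5`.
      have g1 : |(x : ℝ) + x' - (a + t * α)| ≤ 5 / 2 := by
        rw [abs_le]; constructor <;> linarith
      have g2 : |(y : ℝ) + y' - (b + t * β)| ≤ 5 / 2 := by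
        rw [abs_le]; constructor <;> linarith
      linarith
  have hconst : ∀ t, w (a, b) = w (r t) := by
    intro t
    induction t with
    | zero => simp [hr]
    | succ t ih => rw [ih, hstep]
  have hfar : ∀ (z : ℝ) (c : ℤ), z ≠ 0 → ∃ t : ℕ, M ≤ |c + ⌊(t : ℝ) * z⌋| := by
    intro z c hz
    obtain ⟨t, ht⟩ := exists_nat_gt ((|(M : ℝ)| + |(c : ℝ)| + 1) / |z|)
    refine ⟨t, ?_⟩
    rw [div_lt_iff₀ (abs_pos.2 hz)] at ht
    have h1 := Int.floor_le ((t : ℝ) * z)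
    have h2 := Int.lt_floor_add_one ((t : ℝ) * z)
    have h3 : (t : ℝ) * |z| = |t * z| := by rw [abs_mul, Nat.abs_cast]
    rw [h3] at ht
    have h4 : |(t : ℝ) * z| ≤ |(c : ℝ) + ⌊(t : ℝ) * z⌋| + |(c : ℝ)| + 1 := by
      have e1 := le_abs_self ((c : ℝ) + ⌊(t : ℝ) * z⌋)
      have e2 := neg_abs_le ((c : ℝ) + ⌊(t : ℝ) * z⌋)
      have e3 := le_abs_self (c : ℝ)
      have e4 := neg_abs_le (c : ℝ)
      rw [abs_le]; constructor <;> linarith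
    have : (M : ℝ) ≤ |(c : ℝ) + ⌊(t : ℝ) * z⌋| := by linarith [le_abs_self (M : ℝ)]
    exact_mod_cast this
  -- One of the two lattice coordinates of the direction is nonzero, and along it the sampled ray
  -- leaves the box.
  by_cases hα0 : α = 0
  · have hβ0 : β ≠ 0 := by
      rintro rfl
      have := norm_latticePoint_sq α 0
      rw [hhalf, hα0] at this
      norm_num at this
    obtain ⟨t, ht⟩ := hfar β b hβ0
    rw [hconst t]; exact hM _ (Or.inr ht)
  · obtain ⟨t, ht⟩ := hfar α a hα0
    rw [hconst t]; exact hM _ (Or.inl ht)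

/-- A function on the vertices that vanishes far away and that changes only across edges in a cone
away from a large ball vanishes at a given vertex. -/
theorem IsCone.eq_zero_of_jumps {Λ : Set Plane} (hΛ : IsCone Λ) :
    ∃ a : Plane, ∀ v₀ : Vertex, ∃ R : ℝ, ∀ (w : Vertex → ℤ) (M : ℤ),
      (∀ v : Vertex, M ≤ |v.1| ∨ M ≤ |v.2| → w v = 0) →
      (∀ e : Edge, w e.source ≠ w e.target → e.mid ∈ Λ ∧ e.mid ∉ Metric.ball a R) → w v₀ = 0 := by
  obtain ⟨a, v, θ, hv, hθ0, hθ, hcone⟩ := hΛ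
  set κ := Real.cos (θ / 2) with hκ
  -- This is where `θ < 2π` enters: the complement of the cone contains a ray direction, and `1 + κ`
  -- may appear in a denominator.
  have hκ1 : -1 < κ := by
    rw [← Real.cos_pi]
    exact Real.cos_lt_cos_of_nonneg_of_le_pi (by linarith) le_rfl (by linarith)
  have hmem : ∀ x ∈ Λ, ‖x - a‖ * κ ≤ ⟪v, x - a⟫_ℝ := by
    intro x hx
    rcases hcone with h | h <;> rw [h] at hx
    exacts [le_of_lt hx, hx]
  refine ⟨a, fun v₀ => ?_⟩
  set C := ‖Vertex.pos v₀ - a‖ + 5 with hC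
  have hC0 : 0 < C := by positivity
  -- At parameter `s` of the ray with direction `-v`, an edge of the cone near the ray satisfies `κ
  -- ‖x - a‖ ≤ C - s` and `‖x - a‖ ≤ C + s`. This forces `s ≤ C` if `κ ≥ 0` and `s ≤ C (1 - κ) / (1
  -- + κ)` if `κ < 0`, so the edge lies within the chosen radius in either case.
  refine ⟨2 * C + C * (1 - κ) / (1 + κ) + 1, fun w M hM hjump => ?_⟩
  refine eq_zero_of_const_along_ray hM v₀ (u := -v) (by rw [norm_neg, hv]) fun t e he => ?_
  by_contra hne
  obtain ⟨hin, hout⟩ := hjump e hne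
  have h1 := hmem _ hin
  rw [Metric.mem_ball, not_lt, dist_eq_norm] at hout
  set s : ℝ := (t : ℝ) / 2 with hs
  have hs0 : 0 ≤ s := by positivity
  set y : Plane := e.mid - a + s • v with hy
  have hyC : ‖y‖ ≤ C := by
    have : y = (Vertex.pos v₀ - a) + (e.mid - (Vertex.pos v₀ + s • -v)) := by
      rw [hy, smul_neg]; abel
    rw [this]
    exact (norm_add_le _ _).trans (by linarith)
  have hxa : e.mid - a = y - s • v := by rw [hy]; abel
  have hinner : ⟪v, e.mid - a⟫_ℝ ≤ C - s := by
    rw [hxa, inner_sub_right, inner_smul_right, real_inner_self_eq_norm_sq, hv]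
    have := real_inner_le_norm v y
    rw [hv] at this
    linarith
  have hnorm : ‖e.mid - a‖ ≤ C + s := by
    rw [hxa]
    refine (norm_sub_le _ _).trans ?_
    rw [norm_smul, hv, Real.norm_of_nonneg hs0]; linarith
  have hκ2 : κ ≤ 1 := Real.cos_le_one _
  have hq0 : 0 ≤ C * (1 - κ) / (1 + κ) := div_nonneg (mul_nonneg hC0.le (by linarith)) (by linarith)
  rcases le_or_gt 0 κ with hpos | hneg
  · have : 0 ≤ ‖e.mid - a‖ * κ := by positivity
    linarith
  · have h3 : (C + s) * κ ≤ C - s := by nlinarith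
    have h4 : s ≤ C * (1 - κ) / (1 + κ) := by
      rw [le_div_iff₀ (by linarith)]; linarith
    linarith

/-! ## Ribbon operators on flat configurations -/

section FlatConfigurations

variable {G : Type*} [Group G] [Fintype G] [DecidableEq G]

/-- The configuration given by `k(s)⁻¹ H ^ n(e) k(t)` on the edges `e : s → t` with `n(e) ≠ 0` and
unchanged elsewhere. -/
noncomputable def Config.twist (c : Config G) (k : Vertex → G) (H : G) (n : Edge →₀ ℤ) : Config G :=
  ⟨fun e => if n e = 0 then c.1 e else (k e.source)⁻¹ * H ^ n e * k e.target,
    (c.2.union n.hasFiniteSupport).subset fun e he => by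
      by_cases h : n e = 0
      · exact Or.inl (by simpa [h] using he)
      · exact Or.inr h⟩

theorem Config.twist_apply (c : Config G) (k : Vertex → G) (H : G) (n : Edge →₀ ℤ) (e : Edge) :
    (c.twist k H n).1 e = if n e = 0 then c.1 e else (k e.source)⁻¹ * H ^ n e * k e.target := rfl

@[simp] theorem Config.twist_zero (c : Config G) (k : Vertex → G) (H : G) : c.twist k H 0 = c :=
  Config.ext_iff'.2 fun e => by simp [Config.twist_apply]

/-- Adjacent faces share only the ends of their common edge. Hence the vertex of a dual triangle is
an end of its edge, which is not part of the definition of a triangle. -/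
theorem Edge.eq_source_or_target {e : Edge} {v : Vertex} (h : v ∈ e.left.corners)
    (h' : v ∈ e.right.corners) : v = e.source ∨ v = e.target := by
  rcases e with ⟨⟨a, b⟩, d⟩
  rcases v with ⟨x, y⟩
  fin_cases d <;> simp [Edge.left, Edge.right, Edge.target, Face.corners] at h h' ⊢ <;> omega

/-- With `c(e) = k(s)⁻¹ k(t)`, multiplication by `h` at an end `v` of the edge inserts `k(v) h
k(v)⁻¹` between the two factors, whether `v` is the source or the target. -/
theorem actOn_triangleOp_ket (τ : Triangle) (k : Vertex → G) (c : Config G)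
    (hk : c.1 τ.edge = (k τ.edge.source)⁻¹ * k τ.edge.target) (h g : G) :
    actOn (triangleOp τ h g) (ket c) = if (k τ.first.vertex)⁻¹ * k τ.final.vertex = g then
      ket (c.twist k (k τ.first.vertex * h * (k τ.first.vertex)⁻¹) (crossing τ)) else 0 := by
  cases τ with
  | direct s₀ s₁ e hf he =>
    simp only [Triangle.edge] at hk
    simp only [triangleOp, Triangle.first, Triangle.final, crossing, Config.twist_zero]
    rcases he with ⟨h0, h1⟩ | ⟨h0, h1⟩
    · rw [if_pos h0, actOn_edgeT_ket, hk, h0, h1]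
    · rw [if_neg (by rw [h0]; exact e.source_ne_target.symm), actOn_edgeT_ket, hk, h0, h1]
      refine if_congr ?_ rfl rfl
      rw [← inv_inj, inv_inv, mul_inv_rev, inv_inv]
  | dual s₀ s₁ e hv he =>
    simp only [Triangle.edge] at hk
    have hvt : s₀.vertex = e.source ∨ s₀.vertex = e.target := by
      rcases he with ⟨h0, h1⟩ | ⟨h0, h1⟩
      · exact Edge.eq_source_or_target (by rw [← h1, hv]; exact s₁.mem) (by rw [← h0]; exact s₀.mem)
      · exact Edge.eq_source_or_target (by rw [← h0]; exact s₀.mem) (by rw [← h1, hv]; exact s₁.mem)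
    rw [triangleOp_dual]
    simp only [Triangle.first, Triangle.final, crossing, hv, inv_mul_cancel]
    rw [← hv]
    by_cases hg : g = 1
    · rw [if_pos hg, if_pos hg.symm, dualOp]
      by_cases hr : s₀.face = e.right <;> by_cases hs : s₀.vertex = e.source <;>
        simp only [hr, hs, if_true, if_false, actOn_edgeL_ket, actOn_edgeR_ket] <;>
        refine congrArg ket (Config.ext_iff'.2 fun e' => ?_) <;>
        rw [Config.set_apply, Config.twist_apply, Finsupp.single_apply] <;>
        by_cases he' : e' = e
      · subst he'; simp [hk, mul_assoc]
      · simp [he', Ne.symm he']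
      · subst he'; simp [hk, mul_assoc, hvt.resolve_left hs]
      · simp [he', Ne.symm he']
      · subst he'; simp [hk, mul_assoc]
      · simp [he', Ne.symm he']
      · subst he'; simp [hk, mul_assoc, hvt.resolve_left hs]
      · simp [he', Ne.symm he']
    · rw [if_neg hg, if_neg (Ne.symm hg), actOn_zero]

/-- The holonomy from `s` to `s'` is path independent on a flat configuration. The conjugations `k⁻¹
h k` in the recursion are undone by the potential, so the same element is inserted at every crossed
edge. -/
theorem actOn_ribbonOp_ket {ρ : List Triangle} (hnd : (ρ.map Triangle.edge).Nodup) {s s' : Site}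
    (hp : IsPath s ρ s') (k : Vertex → G) (c : Config G)
    (hk : ∀ τ ∈ ρ, c.1 τ.edge = (k τ.edge.source)⁻¹ * k τ.edge.target) (h g : G) :
    actOn (ribbonOp ρ h g) (ket c) = if (k s.vertex)⁻¹ * k s'.vertex = g then
      ket (c.twist k (k s.vertex * h * (k s.vertex)⁻¹) (crossings ρ)) else 0 := by
  induction ρ generalizing s h g with
  | nil =>
    cases hp
    simp only [ribbonOp, crossings_nil, Config.twist_zero, inv_mul_cancel]
    by_cases hg : g = 1
    · simp [hg]
    · simp [hg, Ne.symm hg]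
  | cons τ ρ ih =>
    obtain ⟨rfl, hp⟩ := hp
    rw [List.map_cons, List.nodup_cons] at hnd
    -- No edge occurs twice, so the rest of the ribbon leaves the edge of `τ` untouched and the
    -- potential still describes it.
    have hz : crossings ρ τ.edge = 0 := crossings_apply_eq_zero fun τ' hτ' heq =>
      hnd.1 (by rw [← heq]; exact List.mem_map_of_mem hτ')
    simp only [ribbonOp, actOn_sum, actOn_mul]
    have hstep : ∀ q : G, actOn (triangleOp τ h q)
        (actOn (ribbonOp ρ (q⁻¹ * h * q) (q⁻¹ * g)) (ket c)) =
        if (k τ.first.vertex)⁻¹ * k τ.final.vertex = q then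
          (if (k τ.first.vertex)⁻¹ * k s'.vertex = g then
            ket (c.twist k (k τ.first.vertex * h * (k τ.first.vertex)⁻¹) (crossings (τ :: ρ)))
          else 0) else 0 := by
      intro q
      rw [ih hnd.2 hp fun τ' hτ' => hk τ' (by simp [hτ'])]
      split_ifs with h1 h2 h3 h2 h3
      · rw [actOn_triangleOp_ket τ k _ (by rw [Config.twist_apply, if_pos hz]; exact hk τ (by simp)),
          if_pos h2]
        subst h2
        have hH : k τ.final.vertex * (((k τ.first.vertex)⁻¹ * k τ.final.vertex)⁻¹ * h *
            ((k τ.first.vertex)⁻¹ * k τ.final.vertex)) * (k τ.final.vertex)⁻¹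
            = k τ.first.vertex * h * (k τ.first.vertex)⁻¹ := by group
        rw [hH]
        refine congrArg ket (Config.ext_iff'.2 fun e => ?_)
        simp only [Config.twist_apply, crossings_cons, Finsupp.add_apply]
        by_cases he : τ.edge = e
        · subst he; simp [hz]
        · simp [crossing_apply_eq_zero he]
      · refine absurd ?_ h3
        rw [← h2, mul_inv_rev, inv_inv, mul_assoc, mul_right_inj] at h1
        rw [h1]; simp
      · rw [actOn_triangleOp_ket τ k _ (by rw [Config.twist_apply, if_pos hz]; exact hk τ (by simp)),
          if_neg h2]
      · refine absurd ?_ h1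
        rw [← h2, ← h3]; group
      · simp
      · simp
    simp [hstep]

/-! ## Gauge transformations and flatness -/

theorem ribbonOp_dual_cons (s₀ s₁ : Site) (e : Edge) (hv he) (ρ : List Triangle) (h g : G) :
    ribbonOp (.dual s₀ s₁ e hv he :: ρ) h g = dualOp s₀ e h * ribbonOp ρ h g := by
  rw [ribbonOp, Finset.sum_eq_single 1]
  · simp [triangleOp_dual]
  · intro k _ hk; simp [triangleOp_dual, hk]
  · simp

/-- The gauge transformation at a vertex. -/
noncomputable def gaugeAt (v : Vertex) (h : G) : quasiLocal G := ribbonOp (starRibbon v.1 v.2) h 1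

theorem gaugeAt_eq (a b : ℤ) (h : G) : gaugeAt (a, b) h =
    edgeL ⟨(a, b), 1⟩ h * (edgeR ⟨(a - 1, b + 1), 2⟩ h * (edgeR ⟨(a - 1, b), 0⟩ h *
      (edgeR ⟨(a, b - 1), 1⟩ h * (edgeL ⟨(a, b), 2⟩ h * edgeL ⟨(a, b), 0⟩ h)))) := by
  have hnil : ribbonOp [] h (1 : G) = 1 := if_pos rfl
  simp only [gaugeAt, starRibbon, ribbonOp_dual_cons, hnil]
  have h2 : a ≠ a - 1 := by omega
  have h3 : b ≠ b - 1 := by omega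
  simp [dualOp, Edge.right, h2, h3]

theorem norm_star_mul_operator {K : Type*} [NormedAddCommGroup K] [InnerProductSpace ℂ K]
    [CompleteSpace K] (T : K →L[ℂ] K) : ‖star T * T‖ = ‖T‖ * ‖T‖ := CStarRing.norm_star_mul_self

theorem norm_star_mul_quasiLocal (a : quasiLocal G) : ‖star a * a‖ = ‖a‖ * ‖a‖ :=
  norm_star_mul_operator (a : RefSpace G →L[ℂ] RefSpace G)

theorem norm_le_one_of_mem_unitary {a : quasiLocal G} (ha : a ∈ unitary (quasiLocal G)) :
    ‖a‖ ≤ 1 := by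
  have h1 := norm_star_mul_quasiLocal a
  have h2 : ‖star a * a‖ ≤ 1 := by
    rw [ha.1]
    refine ContinuousLinearMap.opNorm_le_bound _ zero_le_one fun ψ => ?_
    rw [one_mul]
    exact le_rfl
  nlinarith [norm_nonneg a]

theorem norm_gaugeAt_le (v : Vertex) (h : G) : ‖gaugeAt v h‖ ≤ 1 := by
  obtain ⟨a, b⟩ := v
  rw [gaugeAt_eq]
  refine norm_le_one_of_mem_unitary ?_
  exact mul_mem (edgeL_mem_unitary _ _) (mul_mem (edgeR_mem_unitary _ _)
    (mul_mem (edgeR_mem_unitary _ _) (mul_mem (edgeR_mem_unitary _ _)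
      (mul_mem (edgeL_mem_unitary _ _) (edgeL_mem_unitary _ _)))))

theorem exists_gaugeAt_ket (v : Vertex) (h : G) (c : Config G) : ∃ c' : Config G,
    (∀ e, c'.1 e = (if e.source = v then h else 1) * c.1 e * (if e.target = v then h else 1)⁻¹) ∧
      actOn (gaugeAt v h) (ket c) = ket c' := by
  obtain ⟨a, b⟩ := v
  rw [gaugeAt_eq]
  simp only [actOn_mul, actOn_edgeL_ket, actOn_edgeR_ket]
  refine ⟨_, fun e => ?_, rfl⟩
  rcases e with ⟨⟨x, y⟩, d⟩
  fin_cases d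
  · by_cases h1 : x = a ∧ y = b
    · obtain ⟨rfl, rfl⟩ := h1
      have h2 : x ≠ x - 1 := by omega
      have h3 : y ≠ y - 1 := by omega
      simp [Edge.target, h2, h3]
    · by_cases h2 : x = a - 1 ∧ y = b
      · obtain ⟨rfl, rfl⟩ := h2
        simp [Edge.target]
      · have h3 : ¬ (x + 1 = a ∧ y = b) := fun h3 => h2 ⟨by omega, h3.2⟩
        simp [Edge.target, h1, h2, h3]
  · by_cases h1 : x = a ∧ y = b
    · obtain ⟨rfl, rfl⟩ := h1
      have h2 : x ≠ x - 1 := by omega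
      have h3 : y ≠ y - 1 := by omega
      simp [Edge.target, h2, h3]
    · by_cases h2 : x = a ∧ y = b - 1
      · obtain ⟨rfl, rfl⟩ := h2
        simp [Edge.target]
      · have h3 : ¬ (x = a ∧ y + 1 = b) := fun h3 => h2 ⟨h3.1, by omega⟩
        simp [Edge.target, h1, h2, h3]
  · by_cases h1 : x = a ∧ y = b
    · obtain ⟨rfl, rfl⟩ := h1
      have h2 : x ≠ x - 1 := by omega
      have h3 : y ≠ y - 1 := by omega
      simp [Edge.target, h2, h3]
    · by_cases h2 : x = a - 1 ∧ y = b + 1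
      · obtain ⟨rfl, rfl⟩ := h2
        simp [Edge.target]
      · have h3 : ¬ (x + 1 = a ∧ y - 1 = b) := fun h3 => h2 ⟨by omega, by omega⟩
        simp [Edge.target, h1, h2, h3]

/-- The gauge transformation by `x` at the vertices of a list. -/
noncomputable def gaugeList (x : Vertex → G) (l : List Vertex) : quasiLocal G :=
  (l.map fun v => gaugeAt v (x v)).prod

theorem exists_gaugeList_ket (x : Vertex → G) {l : List Vertex} (hl : l.Nodup)
    (c : Config G) : ∃ c' : Config G,
      (∀ e, c'.1 e = (if e.source ∈ l then x e.source else 1) * c.1 e *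
        (if e.target ∈ l then x e.target else 1)⁻¹) ∧ actOn (gaugeList x l) (ket c) = ket c' := by
  induction l with
  | nil => exact ⟨c, fun e => by simp, rfl⟩
  | cons v l ih =>
    rw [List.nodup_cons] at hl
    obtain ⟨c₁, h1, h2⟩ := ih hl.2
    obtain ⟨c₂, h3, h4⟩ := exists_gaugeAt_ket v (x v) c₁
    refine ⟨c₂, fun e => ?_, ?_⟩
    · rw [h3, h1]
      have hm : ∀ u : Vertex, (if u ∈ v :: l then x u else 1) =
          (if u = v then x v else 1) * (if u ∈ l then x u else 1) := by
        intro u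
        by_cases hu : u = v
        · subst hu; simp [hl.1]
        · simp [hu]
      rw [hm, hm]; group
    · rw [gaugeList, List.map_cons, List.prod_cons, actOn_mul]
      change actOn _ (actOn (gaugeList x l) _) = _
      rw [h2, h4]

/-- A configuration is flat at a face if its holonomy around the face is trivial. -/
def Config.FlatAt (c : Config G) : Face → Prop
  | .up a b => c.1 ⟨(a, b), 0⟩ = c.1 ⟨(a, b), 1⟩ * c.1 ⟨(a, b + 1), 2⟩
  | .down a b => c.1 ⟨(a, b + 1), 0⟩ = c.1 ⟨(a, b + 1), 2⟩ * c.1 ⟨(a + 1, b), 1⟩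

theorem actOn_ribbonOp_direct_cons (s₀ s₁ : Site) (e : Edge) (hf he) {ρ : List Triangle} {x : G}
    {c : Config G}
    (hρ : ∀ h g, actOn (ribbonOp ρ h g) (ket c) = if x = g then ket c else 0) (h g : G) :
    actOn (ribbonOp (.direct s₀ s₁ e hf he :: ρ) h g) (ket c) =
      if (if s₀.vertex = e.source then c.1 e else (c.1 e)⁻¹) * x = g then ket c else 0 := by
  simp only [ribbonOp, actOn_sum, actOn_mul, hρ]
  have : ∀ q : G, actOn (triangleOp (.direct s₀ s₁ e hf he) h q)
      (if x = q⁻¹ * g then ket c else 0) =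
      if (if s₀.vertex = e.source then c.1 e else (c.1 e)⁻¹) = q then
        (if (if s₀.vertex = e.source then c.1 e else (c.1 e)⁻¹) * x = g then ket c else 0)
      else 0 := by
    intro q
    have hT : actOn (triangleOp (.direct s₀ s₁ e hf he) h q) (ket c) =
        if (if s₀.vertex = e.source then c.1 e else (c.1 e)⁻¹) = q then ket c else 0 := by
      simp only [triangleOp]
      split_ifs with h1 h2 h3 h3
      · simp [actOn_edgeT_ket, h2]
      · simp [actOn_edgeT_ket, h2]
      · simp [actOn_edgeT_ket, ← h3]
      · rw [actOn_edgeT_ket, if_neg]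
        intro h4; exact h3 (by rw [h4, inv_inv])
    rw [if_congr (eq_inv_mul_iff_mul_eq (a := x) (b := q) (c := g)) rfl rfl]
    by_cases h1 : q * x = g
    · rw [if_pos h1, hT]
      by_cases h2 : (if s₀.vertex = e.source then c.1 e else (c.1 e)⁻¹) = q
      · rw [if_pos h2, if_pos h2, h2, if_pos h1]
      · rw [if_neg h2, if_neg h2]
    · rw [if_neg h1, actOn_vec_zero]
      by_cases h2 : (if s₀.vertex = e.source then c.1 e else (c.1 e)⁻¹) = q
      · rw [if_pos h2, h2, if_neg h1]
      · rw [if_neg h2]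
  simp [this]

open Classical in
theorem actOn_plaquetteOp_ket (f : Face) (c : Config G) :
    actOn (plaquetteOp G f) (ket c) = if c.FlatAt f then ket c else 0 := by
  have hnil : ∀ h g : G, actOn (ribbonOp [] h g) (ket c) = if 1 = g then ket c else 0 := by
    intro h g
    by_cases hg : g = 1
    · simp [ribbonOp, hg]
    · simp [ribbonOp, hg, Ne.symm hg]
  cases f with
  | up a b =>
    simp only [plaquetteOp, plaquetteRibbon]
    rw [actOn_ribbonOp_direct_cons _ _ _ _ _ (actOn_ribbonOp_direct_cons _ _ _ _ _
      (actOn_ribbonOp_direct_cons _ _ _ _ _ hnil))]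
    refine if_congr ?_ rfl rfl
    simp [Config.FlatAt, ← mul_inv_rev, mul_inv_eq_one]
  | down a b =>
    simp only [plaquetteOp, plaquetteRibbon]
    rw [actOn_ribbonOp_direct_cons _ _ _ _ _ (actOn_ribbonOp_direct_cons _ _ _ _ _
      (actOn_ribbonOp_direct_cons _ _ _ _ _ hnil))]
    refine if_congr ?_ rfl rfl
    have hne : (a + 1, b + 1) ≠ (a, b + 1) := by simp
    simp only [Config.FlatAt, if_true, hne, if_false, mul_one]
    rw [mul_eq_one_iff_eq_inv', inv_mul_eq_iff_eq_mul, eq_mul_inv_iff_mul_eq, eq_comm]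

open Classical in
theorem actOn_plaquetteOp_prod_ket (l : List Face) (c : Config G) :
    actOn ((l.map (plaquetteOp G)).prod) (ket c) = if ∀ f ∈ l, c.FlatAt f then ket c else 0 := by
  induction l with
  | nil => simp
  | cons f l ih =>
    rw [List.map_cons, List.prod_cons, actOn_mul, ih]
    by_cases h1 : ∀ f ∈ l, c.FlatAt f
    · rw [if_pos h1, actOn_plaquetteOp_ket]
      refine if_congr ?_ rfl rfl
      simpa using fun _ => h1
    · rw [if_neg h1, actOn_vec_zero, if_neg]
      exact fun h2 => h1 fun f hf => h2 f (by simp [hf])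

theorem norm_plaquetteOp_le (f : Face) : ‖plaquetteOp G f‖ ≤ 1 := by
  classical
  have hs : star (plaquetteOp G f) = plaquetteOp G f := by
    refine Subtype.ext (star_eq_of_inner_ket fun c c' => ?_)
    have h1 := actOn_plaquetteOp_ket f c
    have h2 := actOn_plaquetteOp_ket f c'
    simp only [actOn] at h1 h2
    rw [h1, h2]
    have h3 : ⟪ket c, ket c'⟫_ℂ = if c = c' then 1 else 0 := by rw [inner_ket_left, ket_apply]
    by_cases hc : c = c'
    · subst hc; split_ifs <;> simp
    · split_ifs <;> simp [h3, hc]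
  have hm : plaquetteOp G f * plaquetteOp G f = plaquetteOp G f := by
    refine quasiLocal_ext_ket fun c => ?_
    rw [actOn_mul, actOn_plaquetteOp_ket]
    split_ifs with h
    · rw [actOn_plaquetteOp_ket, if_pos h]
    · simp
  have h1 := norm_star_mul_quasiLocal (plaquetteOp G f)
  rw [hs, hm] at h1
  nlinarith [norm_nonneg (plaquetteOp G f)]

/-- The potential is the holonomy along the bottom row of the box and then up a column. Flatness of
the triangles makes it compatible with the edges of the other directions. -/
theorem exists_potential {M : ℤ} {c : Config G}
    (hc : ∀ a b : ℤ, -M ≤ a → a ≤ M → -M ≤ b → b ≤ M → c.FlatAt (.up a b) ∧ c.FlatAt (.down a b)) :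
    ∃ k : Vertex → G, ∀ e : Edge, |e.source.1| < M → |e.source.2| < M →
      c.1 e = (k e.source)⁻¹ * k e.target := by
  set C : ℕ → ℕ → Fin 3 → G := fun i j d => c.1 ⟨((i : ℤ) - M, (j : ℤ) - M), d⟩ with hC
  let row : ℕ → G := fun i => Nat.rec 1 (fun i r => r * C i 0 0) i
  let K : ℕ → ℕ → G := fun i j => Nat.rec (row i) (fun j r => r * C i j 1) j
  have hrow : ∀ i, K (i + 1) 0 = K i 0 * C i 0 0 := fun _ => rfl
  have hK1 : ∀ i j, K i (j + 1) = K i j * C i j 1 := fun _ _ => rfl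
  have hup : ∀ i j : ℕ, (i : ℤ) ≤ 2 * M → (j : ℤ) ≤ 2 * M →
      C i j 0 = C i j 1 * C i (j + 1) 2 := by
    intro i j hi hj
    have := (hc (i - M) (j - M) (by omega) (by omega) (by omega) (by omega)).1
    simp only [Config.FlatAt] at this
    have e1 : ((j : ℤ) - M + 1) = ((j + 1 : ℕ) : ℤ) - M := by push_cast; ring
    rw [e1] at this
    exact this
  have hdown : ∀ i j : ℕ, (i : ℤ) ≤ 2 * M → (j : ℤ) ≤ 2 * M →
      C i (j + 1) 0 = C i (j + 1) 2 * C (i + 1) j 1 := by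
    intro i j hi hj
    have := (hc (i - M) (j - M) (by omega) (by omega) (by omega) (by omega)).2
    simp only [Config.FlatAt] at this
    have e1 : ((j : ℤ) - M + 1) = ((j + 1 : ℕ) : ℤ) - M := by push_cast; ring
    have e2 : ((i : ℤ) - M + 1) = ((i + 1 : ℕ) : ℤ) - M := by push_cast; ring
    rw [e1, e2] at this
    exact this
  have hK0 : ∀ j i : ℕ, (i : ℤ) ≤ 2 * M → (j : ℤ) ≤ 2 * M → K (i + 1) j = K i j * C i j 0 := by
    intro j
    induction j with
    | zero => intro i _ _; exact hrow i
    | succ j ih =>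
      intro i hi hj
      rw [hK1 (i + 1) j, ih i hi (by push_cast at hj; omega), hK1 i j,
        hup i j hi (by push_cast at hj; omega), hdown i j hi (by push_cast at hj; omega)]
      group
  refine ⟨fun v => K (v.1 + M).toNat (v.2 + M).toNat, ?_⟩
  rintro ⟨⟨x, y⟩, d⟩ hx hy
  simp only [abs_lt] at hx hy
  obtain ⟨i, hi⟩ : ∃ i : ℕ, x = i - M := ⟨(x + M).toNat, by omega⟩
  -- The shift by one keeps the target of an edge of direction `2`, one row lower, inside the box.
  obtain ⟨j, hj⟩ : ∃ j : ℕ, y = (j + 1 : ℕ) - M := ⟨(y + M).toNat - 1, by omega⟩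
  subst hi hj
  have hi2 : (i : ℤ) ≤ 2 * M := by omega
  have hj2 : ((j + 1 : ℕ) : ℤ) ≤ 2 * M := by omega
  have t1 : ((i : ℤ) - M + M).toNat = i := by omega
  have t2 : ((i : ℤ) - M + 1 + M).toNat = i + 1 := by omega
  have t3 : (((j + 1 : ℕ) : ℤ) - M + M).toNat = j + 1 := by omega
  have t4 : (((j + 1 : ℕ) : ℤ) - M + 1 + M).toNat = j + 2 := by omega
  have t5 : (((j + 1 : ℕ) : ℤ) - M - 1 + M).toNat = j := by omega
  rw [eq_inv_mul_iff_mul_eq]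
  fin_cases d
  · show K _ _ * _ = K (((i : ℤ) - M + 1 + M).toNat) ((((j + 1 : ℕ) : ℤ) - M + M).toNat)
    simp only [t1, t2, t3]
    exact (hK0 (j + 1) i hi2 hj2).symm
  · show K _ _ * _ = K (((i : ℤ) - M + M).toNat) ((((j + 1 : ℕ) : ℤ) - M + 1 + M).toNat)
    simp only [t1, t4, t3]
    exact (hK1 i (j + 1)).symm
  · show K _ _ * _ = K (((i : ℤ) - M + 1 + M).toNat) ((((j + 1 : ℕ) : ℤ) - M - 1 + M).toNat)
    simp only [t1, t2, t3, t5]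
    rw [hK0 j i hi2 (by push_cast at hj2; omega), hK1, hup i j hi2 (by push_cast at hj2; omega)]
    exact mul_assoc _ _ _

end FlatConfigurations

/-! ## Deformation of ribbons in the ground state -/

section Deformation

variable {G : Type*} [Group G] [Fintype G] [DecidableEq G]

/-- The extension by `1` of a gauge parameter on a finite set of vertices. -/
def extendGauge (S : Finset Vertex) (x : S → G) (v : Vertex) : G :=
  if hv : v ∈ S then x ⟨v, hv⟩ else 1

/-- The faces with coordinates between `-M` and `M`. -/
noncomputable def boxFaces (M : ℤ) : List Face :=
  (Finset.Icc (-M) M ×ˢ Finset.Icc (-M) M).toList.map (fun p => Face.up p.1 p.2) ++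
    (Finset.Icc (-M) M ×ˢ Finset.Icc (-M) M).toList.map (fun p => Face.down p.1 p.2)

theorem exists_potential_of_boxFaces {M : ℤ} {c : Config G} (hc : ∀ f ∈ boxFaces M, c.FlatAt f) :
    ∃ k : Vertex → G, ∀ e : Edge, |e.source.1| < M → |e.source.2| < M →
      c.1 e = (k e.source)⁻¹ * k e.target :=
  exists_potential fun a b h1 h2 h3 h4 =>
    ⟨hc _ (by simp [boxFaces, h1, h2, h3, h4]), hc _ (by simp [boxFaces, h1, h2, h3, h4])⟩

theorem Edge.abs_source_le {e : Edge} {M : ℤ}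
    (h : (|e.source.1| < M ∧ |e.source.2| < M) ∨ (|e.target.1| < M ∧ |e.target.2| < M)) :
    |e.source.1| < M + 1 ∧ |e.source.2| < M + 1 := by
  rcases h with h | h
  · omega
  · rcases e with ⟨⟨a, b⟩, d⟩
    fin_cases d <;> simp only [Edge.target, abs_lt] at h ⊢ <;> simp at h ⊢ <;> omega

/-- The plaquette projections leave only flat configurations, on which the two ribbon operators
differ by a gauge transformation supported where `w ≠ 0`. Summing over all gauge parameters on that
finite set absorbs the difference. -/
theorem exists_ribbonOp_sub_mul_eq_zero {ρ ρ' : List Triangle} (hρ : (ρ.map Triangle.edge).Nodup)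
    (hρ' : (ρ'.map Triangle.edge).Nodup) {s s' : Site} (hp : IsPath s ρ s') (hp' : IsPath s ρ' s')
    {w : Vertex → ℤ} (hw : IsWinding (crossings ρ - crossings ρ') w) {M₀ : ℤ}
    (hM₀ : ∀ v : Vertex, M₀ ≤ |v.1| ∨ M₀ ≤ |v.2| → w v = 0) (hs : w s.vertex = 0)
    (hs' : w s'.vertex = 0) :
    ∃ (S : Finset Vertex) (l : List Face), ∀ h g : G, (ribbonOp ρ h g - ribbonOp ρ' h g) *
      ((∑ x : S → G, gaugeList (extendGauge S x) S.toList) * (l.map (plaquetteOp G)).prod) = 0 := by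
  classical
  obtain ⟨M₁, hM₁0, hM₁⟩ := exists_coordinate_bound ((ρ ++ ρ').map Triangle.edge).toFinset
  -- The margin of one covers the targets of edges: an edge starting outside this box has `w = 0` at
  -- both ends and is crossed by neither ribbon.
  set M := max M₀ M₁ + 1 with hM
  set S : Finset Vertex :=
    (Finset.Icc (-M₀) M₀ ×ˢ Finset.Icc (-M₀) M₀).filter fun v => w v ≠ 0 with hS
  have hmemS : ∀ v, v ∈ S ↔ w v ≠ 0 := by
    intro v
    simp only [hS, Finset.mem_filter, Finset.mem_product, Finset.mem_Icc, and_iff_right_iff_imp]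
    intro hv
    by_contra hcon
    refine hv (hM₀ v ?_)
    rw [le_abs, le_abs]; omega
  have hbox : ∀ e : Edge, ¬ (|e.source.1| < M ∧ |e.source.2| < M) →
      w e.source = 0 ∧ w e.target = 0 ∧ crossings ρ e = 0 ∧ crossings ρ' e = 0 := by
    intro e he
    refine ⟨?_, ?_, ?_, ?_⟩
    · refine hM₀ _ ?_; omega
    · refine hM₀ _ ?_
      by_contra hcon
      have := Edge.abs_source_le (e := e) (M := M₀) (Or.inr (by omega))
      omega
    all_goals
      refine crossings_apply_eq_zero fun τ hτ heq => ?_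
      have := hM₁ e (by rw [List.mem_toFinset, ← heq]; exact List.mem_map_of_mem (by simp [hτ]))
      omega
  have hedge : ∀ τ ∈ ρ ++ ρ', |τ.edge.source.1| < M ∧ |τ.edge.source.2| < M := by
    intro τ hτ
    have := hM₁ τ.edge (by rw [List.mem_toFinset]; exact List.mem_map_of_mem hτ)
    omega
  refine ⟨S, boxFaces M, fun h g => quasiLocal_ext_ket fun c => ?_⟩
  rw [actOn_mul, actOn_mul, actOn_plaquetteOp_prod_ket]
  split_ifs with hflat
  swap
  · simp
  obtain ⟨k, hk⟩ := exists_potential_of_boxFaces hflat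
  choose cx hcx hact using fun x : S → G => exists_gaugeList_ket (extendGauge S x) S.nodup_toList c
  have hext : ∀ (x : S → G) (v : Vertex),
      (if v ∈ S.toList then extendGauge S x v else 1) = extendGauge S x v := by
    intro x v
    by_cases hv : v ∈ S <;> simp [hv, extendGauge]
  simp only [hext] at hcx
  have hone : ∀ (x : S → G) (v : Vertex), w v = 0 → extendGauge S x v = 1 := by
    intro x v hv
    rw [extendGauge, dif_neg]
    rw [hmemS]; exact fun h => h hv
  rw [actOn_sum, actOn_vec_sum]
  simp only [hact, actOn_sub, actOn_zero]
  rw [Finset.sum_sub_distrib, sub_eq_zero]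
  set H := k s.vertex * h * (k s.vertex)⁻¹ with hH
  have hflatx : ∀ (x : S → G) (e : Edge), |e.source.1| < M ∧ |e.source.2| < M →
      (cx x).1 e = (k e.source * (extendGauge S x e.source)⁻¹)⁻¹ *
        (k e.target * (extendGauge S x e.target)⁻¹) := by
    intro x e he
    rw [hcx, hk e he.1 he.2]; group
  -- Since `w` vanishes at the end points, the gauge parameter is `1` there, and neither the
  -- holonomy nor `H` depends on `x`.
  have hF : ∀ x, actOn (ribbonOp ρ h g) (ket (cx x)) = if (k s.vertex)⁻¹ * k s'.vertex = g then
      ket ((cx x).twist (fun v => k v * (extendGauge S x v)⁻¹) H (crossings ρ)) else 0 := by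
    intro x
    rw [actOn_ribbonOp_ket hρ hp (fun v => k v * (extendGauge S x v)⁻¹) (cx x)
      (fun τ hτ => hflatx x _ (hedge τ (by simp [hτ])))]
    simp only [hone x _ hs, hone x _ hs', inv_one, mul_one, hH]
  have hF' : ∀ x, actOn (ribbonOp ρ' h g) (ket (cx x)) = if (k s.vertex)⁻¹ * k s'.vertex = g then
      ket ((cx x).twist (fun v => k v * (extendGauge S x v)⁻¹) H (crossings ρ')) else 0 := by
    intro x
    rw [actOn_ribbonOp_ket hρ' hp' (fun v => k v * (extendGauge S x v)⁻¹) (cx x)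
      (fun τ hτ => hflatx x _ (hedge τ (by simp [hτ])))]
    simp only [hone x _ hs, hone x _ hs', inv_one, mul_one, hH]
  simp only [hF, hF']
  -- Right multiplication of the gauge parameter by `k⁻¹ H^w k` is a bijection. It turns the
  -- exponents of `ρ'` into those of `ρ`, because `w(s) - w(t)` is the difference of the crossing
  -- numbers on an edge from `s` to `t`.
  refine Fintype.sum_equiv
    (Equiv.mulRight fun v : S => (k v)⁻¹ * H ^ w v * k v) _ _ fun x => ?_
  refine if_congr Iff.rfl (congrArg ket (Config.ext_iff'.2 fun e => ?_)) rfl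
  have hz : ∀ v, extendGauge S (x * fun v : S => (k v)⁻¹ * H ^ w v * k v) v
      = extendGauge S x v * ((k v)⁻¹ * H ^ w v * k v) := by
    intro v
    by_cases hv : v ∈ S
    · simp [extendGauge, hv]
    · have : w v = 0 := by simpa using fun h => hv ((hmemS v).2 h)
      rw [hone _ _ this, hone _ _ this, this]; simp
  rw [Equiv.coe_mulRight]
  by_cases he : |e.source.1| < M ∧ |e.source.2| < M
  · have hn : w e.source - w e.target = crossings ρ e - crossings ρ' e := hw e
    have hform : ∀ (y : S → G) (n : Edge →₀ ℤ),
        ((cx y).twist (fun v => k v * (extendGauge S y v)⁻¹) H n).1 e =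
        (k e.source * (extendGauge S y e.source)⁻¹)⁻¹ * H ^ n e *
          (k e.target * (extendGauge S y e.target)⁻¹) := by
      intro y n
      rw [Config.twist_apply]
      split_ifs with h0
      · rw [h0, hflatx y e he]; simp
      · rfl
    rw [hform, hform, hz, hz]
    have hpow : H ^ crossings ρ e = H ^ w e.source * H ^ crossings ρ' e * (H ^ w e.target)⁻¹ := by
      rw [← zpow_neg, ← zpow_add, ← zpow_add]; congr 1; omega
    rw [hpow]
    group
  · obtain ⟨h1, h2, h3, h4⟩ := hbox e he
    rw [Config.twist_apply, Config.twist_apply, if_pos h3, if_pos h4, hcx, hcx]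
    simp only [hone _ _ h1, hone _ _ h2]

/-! ### The ground state vector -/

variable {H : Type*} [NormedAddCommGroup H] [InnerProductSpace ℂ H] [CompleteSpace H]
  {ω₀ : quasiLocal G →ₗ[ℂ] ℂ} {π₀ : quasiLocal G →⋆ₐ[ℂ] (H →L[ℂ] H)} {Ω : H}

theorem norm_ground_vector (hω₀ : IsFrustrationFreeGroundState ω₀) (hGNS : IsGNSTriple ω₀ π₀ Ω) :
    ‖Ω‖ = 1 := by
  have h := hGNS.vector_state 1
  rw [hω₀.map_one, map_one, one_apply_eq_self, inner_self_eq_norm_sq_to_K] at h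
  have h1 : ((‖Ω‖ ^ 2 : ℝ) : ℂ) = 1 := by rw [h]; norm_cast
  have h2 : ‖Ω‖ ^ 2 = 1 := by exact_mod_cast h1
  exact (pow_eq_one_iff_of_nonneg (norm_nonneg _) two_ne_zero).1 h2

/-- The case of equality in the Cauchy–Schwarz inequality for a contraction and the unit vector `Ω`.
-/
theorem apply_ground_vector_eq_self (hω₀ : IsFrustrationFreeGroundState ω₀)
    (hGNS : IsGNSTriple ω₀ π₀ Ω) {a : quasiLocal G} (ha : ‖a‖ ≤ 1) (h : ω₀ a = 1) :
    π₀ a Ω = Ω := by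
  have h1 := norm_ground_vector hω₀ hGNS
  have h2 : ‖π₀ a Ω‖ ≤ 1 := by
    calc ‖π₀ a Ω‖ ≤ ‖π₀ a‖ * ‖Ω‖ := (π₀ a).le_opNorm Ω
      _ ≤ 1 := by rw [h1, mul_one]; exact (norm_map_le π₀ a).trans ha
  have h3 : ⟪Ω, π₀ a Ω⟫_ℂ = 1 := by rw [← hGNS.vector_state, h]
  have h4 : ‖π₀ a Ω - Ω‖ ^ 2 ≤ 0 := by
    have h5 : ⟪π₀ a Ω, Ω⟫_ℂ = 1 := by rw [← inner_conj_symm, h3, map_one]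
    rw [norm_sub_sq (𝕜 := ℂ), h5, h1]
    simp only [RCLike.one_re]
    nlinarith [norm_nonneg (π₀ a Ω)]
  have h6 : ‖π₀ a Ω - Ω‖ = 0 := by nlinarith [norm_nonneg (π₀ a Ω - Ω)]
  exact sub_eq_zero.1 (norm_eq_zero.1 h6)

theorem plaquetteOp_apply_ground_vector (hω₀ : IsFrustrationFreeGroundState ω₀)
    (hGNS : IsGNSTriple ω₀ π₀ Ω) (f : Face) : π₀ (plaquetteOp G f) Ω = Ω :=
  apply_ground_vector_eq_self hω₀ hGNS (norm_plaquetteOp_le f) (hω₀.plaquette_eq_one f)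

theorem starOp_eq (v : Vertex) : starOp G v = (Fintype.card G : ℂ)⁻¹ • ∑ h : G, gaugeAt v h := rfl

theorem norm_starOp_le (v : Vertex) : ‖starOp G v‖ ≤ 1 := by
  have hc : (0 : ℝ) < Fintype.card G := by exact_mod_cast Fintype.card_pos
  rw [starOp_eq, norm_smul, norm_inv, Complex.norm_natCast, inv_mul_le_iff₀ hc, mul_one]
  refine (norm_sum_le _ _).trans ?_
  refine (Finset.sum_le_sum fun h _ => norm_gaugeAt_le v h).trans ?_
  simp

theorem gaugeAt_mul (v : Vertex) (g h : G) : gaugeAt v g * gaugeAt v h = gaugeAt v (g * h) := by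
  refine quasiLocal_ext_ket fun c => ?_
  obtain ⟨c₁, h1, h1'⟩ := exists_gaugeAt_ket v h c
  obtain ⟨c₂, h2, h2'⟩ := exists_gaugeAt_ket v g c₁
  obtain ⟨c₃, h3, h3'⟩ := exists_gaugeAt_ket v (g * h) c
  rw [actOn_mul, h1', h2', h3']
  refine congrArg ket (Config.ext_iff'.2 fun e => ?_)
  rw [h2, h1, h3]
  split_ifs <;> simp [mul_assoc]

/-- `A_v` is the average of the gauge group at `v` and thus absorbs each of its elements, while `Ω`
is fixed by `A_v`. -/
theorem gaugeAt_apply_ground_vector (hω₀ : IsFrustrationFreeGroundState ω₀)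
    (hGNS : IsGNSTriple ω₀ π₀ Ω) (v : Vertex) (h : G) : π₀ (gaugeAt v h) Ω = Ω := by
  have h1 := apply_ground_vector_eq_self hω₀ hGNS (norm_starOp_le v) (hω₀.star_eq_one v)
  have h2 : gaugeAt v h * starOp G v = starOp G v := by
    rw [starOp_eq, mul_smul_comm, Finset.mul_sum]
    congr 1
    exact Fintype.sum_equiv (Equiv.mulLeft h) _ _ fun g => by simp [gaugeAt_mul]
  rw [← h1, ← mul_apply_eq_comp, ← map_mul, h2]

theorem map_list_prod_apply_eq_self {l : List (quasiLocal G)} (h : ∀ a ∈ l, π₀ a Ω = Ω) :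
    π₀ l.prod Ω = Ω := by
  induction l with
  | nil => simp
  | cons a l ih =>
    rw [List.prod_cons, map_mul, mul_apply_eq_comp, ih fun b hb => h b (by simp [hb]),
      h a (by simp)]

/-- Ribbon operators of ribbons with the same end sites create the same state, provided that the
loop formed by the two ribbons does not wind around the vertices of the end sites. -/
theorem ribbonOp_apply_ground_vector_eq (hω₀ : IsFrustrationFreeGroundState ω₀)
    (hGNS : IsGNSTriple ω₀ π₀ Ω) {ρ ρ' : List Triangle} (hρ : (ρ.map Triangle.edge).Nodup)
    (hρ' : (ρ'.map Triangle.edge).Nodup) {s s' : Site} (hp : IsPath s ρ s') (hp' : IsPath s ρ' s')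
    {w : Vertex → ℤ} (hw : IsWinding (crossings ρ - crossings ρ') w) {M₀ : ℤ}
    (hM₀ : ∀ v : Vertex, M₀ ≤ |v.1| ∨ M₀ ≤ |v.2| → w v = 0) (hs : w s.vertex = 0)
    (hs' : w s'.vertex = 0) (h g : G) : π₀ (ribbonOp ρ h g) Ω = π₀ (ribbonOp ρ' h g) Ω := by
  obtain ⟨S, l, hSl⟩ := exists_ribbonOp_sub_mul_eq_zero (G := G) hρ hρ' hp hp' hw hM₀ hs hs'
  have hP : π₀ (l.map (plaquetteOp G)).prod Ω = Ω := by
    refine map_list_prod_apply_eq_self fun a ha => ?_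
    obtain ⟨f, _, rfl⟩ := List.mem_map.1 ha
    exact plaquetteOp_apply_ground_vector hω₀ hGNS f
  have hU : ∀ x : S → G, π₀ (gaugeList (extendGauge S x) S.toList) Ω = Ω := by
    intro x
    refine map_list_prod_apply_eq_self fun a ha => ?_
    obtain ⟨v, _, rfl⟩ := List.mem_map.1 ha
    exact gaugeAt_apply_ground_vector hω₀ hGNS v _
  have h0 := congrArg (fun a => π₀ a Ω) (hSl h g)
  simp only [map_mul, map_sum, map_sub, map_zero, mul_apply_eq_comp, hP, sum_apply, hU,
    Finset.sum_const, zero_apply, map_nsmul, sub_apply] at h0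
  -- On `Ω` every gauge transformation is trivial, so their sum acts as the number of gauge
  -- parameters, which is cancelled.
  have hcard : (Finset.univ : Finset (S → G)).card ≠ 0 := by
    rw [Finset.card_univ]; exact Fintype.card_ne_zero
  rw [← Nat.cast_smul_eq_nsmul ℂ, smul_eq_zero] at h0
  rcases h0 with h0 | h0
  · exact absurd (by exact_mod_cast h0) hcard
  · exact sub_eq_zero.1 h0

end Deformation

/-! ## Bridges -/

section Bridges

theorem oppRibbon_append (ρ ρ' : List Triangle) :
    oppRibbon (ρ ++ ρ') = oppRibbon ρ' ++ oppRibbon ρ := by simp [oppRibbon]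

theorem oppRibbon_oppRibbon (ρ : List Triangle) : oppRibbon (oppRibbon ρ) = ρ := by
  simp only [oppRibbon, List.map_reverse, List.reverse_reverse, List.map_map]
  conv_rhs => rw [← List.map_id ρ]
  exact List.map_congr_left fun τ _ => τ.opp_opp

theorem Triangle.edge_opp (τ : Triangle) : τ.opp.edge = τ.edge := by cases τ <;> rfl
theorem Triangle.first_opp (τ : Triangle) : τ.opp.first = τ.final := by cases τ <;> rfl
theorem Triangle.final_opp (τ : Triangle) : τ.opp.final = τ.first := by cases τ <;> rfl

theorem map_edge_oppRibbon (ρ : List Triangle) :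
    (oppRibbon ρ).map Triangle.edge = (ρ.map Triangle.edge).reverse := by
  rw [oppRibbon, List.map_reverse, List.map_map]
  congr 1
  exact List.map_congr_left fun τ _ => τ.edge_opp

theorem IsRibbon.oppRibbon {ρ : List Triangle} (h : IsRibbon ρ) : IsRibbon (oppRibbon ρ) := by
  refine ⟨?_, ?_⟩
  · rw [_root_.oppRibbon, List.isChain_reverse, List.isChain_map]
    refine h.1.imp fun τ τ' hτ => ?_
    rw [Triangle.final_opp, Triangle.first_opp, hτ]
  · rw [map_edge_oppRibbon, List.nodup_reverse]; exact h.2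

theorem mem_oppRibbon {ρ : List Triangle} {τ : Triangle} (h : τ ∈ oppRibbon ρ) :
    ∃ τ' ∈ ρ, τ'.edge = τ.edge := by
  simp only [oppRibbon, List.mem_reverse, List.mem_map] at h
  obtain ⟨τ', h1, rfl⟩ := h
  exact ⟨τ', h1, τ'.edge_opp.symm⟩

theorem RibbonIn.oppRibbon {ρ : List Triangle} {S : Set Plane} (h : RibbonIn ρ S) :
    RibbonIn (oppRibbon ρ) S := by
  intro τ hτ
  obtain ⟨τ', h1, h2⟩ := mem_oppRibbon hτ
  rw [← h2]; exact h τ' h1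

theorem oppRibbon_intertwiningRibbon (ρ ρ' : HalfInfiniteRibbon) (ξ : ℕ → List Triangle) (m : ℕ) :
    oppRibbon (intertwiningRibbon ρ ρ' ξ m)
      = intertwiningRibbon ρ' ρ (fun m => oppRibbon (ξ m)) m := by
  simp only [intertwiningRibbon, oppRibbon_append, oppRibbon_oppRibbon, List.append_assoc]

/-- Reversed intertwining ribbons come from the reversed bridge, so strong convergence for arbitrary
bridges also yields that of the adjoints. -/
theorem IsBridge.symm {ρ ρ' : HalfInfiniteRibbon} {ξ : ℕ → List Triangle} (h : IsBridge ρ ρ' ξ) :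
    IsBridge ρ' ρ fun m => oppRibbon (ξ m) where
  ribbon m hm := (h.ribbon m hm).oppRibbon
  concat m hm := by rw [← oppRibbon_intertwiningRibbon]; exact (h.concat m hm).oppRibbon
  escapes x r := (h.escapes x r).mono fun _ hm => hm.oppRibbon

/-- The part of the intertwining ribbon between the triangles number `K` of the two half-infinite
ribbons. -/
def middleRibbon (ρ ρ' : HalfInfiniteRibbon) (ξ : ℕ → List Triangle) (K m : ℕ) : List Triangle :=
  ρ.segment K m ++ ξ m ++ oppRibbon (ρ'.segment K m)

theorem intertwiningRibbon_eq (ρ ρ' : HalfInfiniteRibbon) (ξ : ℕ → List Triangle) {K m : ℕ}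
    (h : K ≤ m) : intertwiningRibbon ρ ρ' ξ m =
      ρ.initial K ++ middleRibbon ρ ρ' ξ K m ++ oppRibbon (ρ'.initial K) := by
  rw [intertwiningRibbon, ρ.initial_eq_append h, ρ'.initial_eq_append h, oppRibbon_append,
    middleRibbon]
  simp only [List.append_assoc]

theorem HalfInfiniteRibbon.segment_append (ρ : HalfInfiniteRibbon) {K N m : ℕ} (h : K ≤ N)
    (h' : N ≤ m) : ρ.segment K m = ρ.segment K N ++ ρ.segment N m := by
  have h1 := ρ.initial_eq_append (h.trans h')
  rw [ρ.initial_eq_append h', ρ.initial_eq_append h, List.append_assoc] at h1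
  exact (List.append_cancel_left h1).symm

theorem HalfInfiniteRibbon.segment_self_succ (ρ : HalfInfiniteRibbon) (K : ℕ) :
    ρ.segment K (K + 1) = [ρ.tri K] := by
  simp [segment]

theorem isRibbon_middleRibbon {ρ ρ' : HalfInfiniteRibbon} {ξ : ℕ → List Triangle}
    (hξ : IsBridge ρ ρ' ξ) {K m : ℕ} (h : K + 1 ≤ m) : IsRibbon (middleRibbon ρ ρ' ξ K m) := by
  have h1 := hξ.concat m (by omega)
  rw [intertwiningRibbon_eq ρ ρ' ξ (K := K) (by omega)] at h1
  have hinf : middleRibbon ρ ρ' ξ K m <:+: ρ.initial K ++ middleRibbon ρ ρ' ξ K m ++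
      oppRibbon (ρ'.initial K) := ⟨_, _, rfl⟩
  exact ⟨h1.1.infix hinf, h1.2.sublist (hinf.sublist.map _)⟩

/-- With `K + 1 ≤ m` the middle part begins with triangle `K` of `ρ` and ends with the opposite of
triangle `K` of `ρ'`, so its end sites do not depend on `m`. -/
theorem isPath_middleRibbon {ρ ρ' : HalfInfiniteRibbon} {ξ : ℕ → List Triangle}
    (hξ : IsBridge ρ ρ' ξ) {K m : ℕ} (h : K + 1 ≤ m) :
    IsPath (ρ.tri K).first (middleRibbon ρ ρ' ξ K m) (ρ'.tri K).first := by
  have h1 := (isRibbon_middleRibbon hξ h).1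
  have h2 : middleRibbon ρ ρ' ξ K m = ρ.tri K :: ((ρ.segment (K + 1) m ++ ξ m ++
      oppRibbon (ρ'.segment (K + 1) m)) ++ [(ρ'.tri K).opp]) := by
    rw [middleRibbon, ρ.segment_append (Nat.le_succ K) h, ρ'.segment_append (Nat.le_succ K) h,
      HalfInfiniteRibbon.segment_self_succ, HalfInfiniteRibbon.segment_self_succ, oppRibbon_append]
    simp [oppRibbon]
  rw [h2] at h1 ⊢
  rw [← Triangle.final_opp (ρ'.tri K)]
  exact isPath_of_isChain h1

variable {G : Type*} [Group G] [Fintype G] [DecidableEq G]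
  {H : Type*} [NormedAddCommGroup H] [InnerProductSpace ℂ H] [CompleteSpace H]
  {ω₀ : quasiLocal G →ₗ[ℂ] ℂ} {π₀ : quasiLocal G →⋆ₐ[ℂ] (H →L[ℂ] H)} {Ω : H}

/-- The state created by the middle part of the intertwining ribbons is eventually constant. -/
theorem middleRibbon_apply_ground_vector (hω₀ : IsFrustrationFreeGroundState ω₀)
    (hGNS : IsGNSTriple ω₀ π₀ Ω) {Λ : Set Plane} (hΛ : IsCone Λ) {ρ ρ' : HalfInfiniteRibbon}
    {ξ : ℕ → List Triangle} (hξ : IsBridge ρ ρ' ξ)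
    (hσΛ : ∀ m, 1 ≤ m → RibbonIn (intertwiningRibbon ρ ρ' ξ m) Λ) (K : ℕ) :
    ∃ N, K + 1 ≤ N ∧ ∀ m ≥ N, ∀ h g : G,
      π₀ (ribbonOp (middleRibbon ρ ρ' ξ K m) h g) Ω
        = π₀ (ribbonOp (middleRibbon ρ ρ' ξ K N) h g) Ω := by
  obtain ⟨a, ha⟩ := hΛ.eq_zero_of_jumps
  obtain ⟨R₁, hR₁⟩ := ha (ρ.tri K).first.vertex
  obtain ⟨R₂, hR₂⟩ := ha (ρ'.tri K).first.vertex
  set R := max R₁ R₂ with hR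
  obtain ⟨N₁, hN₁⟩ := ρ.eventually_edge_notMem (edgesIn_ball_finite a R)
  obtain ⟨N₂, hN₂⟩ := ρ'.eventually_edge_notMem (edgesIn_ball_finite a R)
  obtain ⟨N₃, hN₃⟩ := eventually_atTop.1 (hξ.escapes a R)
  set N := max (max (K + 1) N₁) (max N₂ N₃) with hN
  refine ⟨N, by omega, fun m hm h g => ?_⟩
  have hKN : K ≤ N := by omega
  have hp := isPath_middleRibbon hξ (K := K) (m := m) (by omega)
  have hp' := isPath_middleRibbon hξ (K := K) (m := N) (by omega)
  obtain ⟨w, hw, M, hM⟩ := exists_isWinding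
    (n := crossings (middleRibbon ρ ρ' ξ K m) - crossings (middleRibbon ρ ρ' ξ K N)) fun f => by
      rw [influx_sub, influx_crossings hp, influx_crossings hp', sub_self]
  -- The pieces of `ρ` and `ρ'` between `K` and `N` occur in both middle parts and cancel. Only the
  -- bridges and the pieces beyond `N` contribute jumps, and they lie in `Λ` outside the ball.
  have hfar : ∀ e : Edge, w e.source ≠ w e.target → e.mid ∈ Λ ∧ e.mid ∉ Metric.ball a R := by
    intro e he
    by_contra hcon
    refine he (sub_eq_zero.1 ((hw e).trans ?_))
    have hlist : ∀ (l : List Triangle) (m' : ℕ), 1 ≤ m' →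
        (∀ τ ∈ l, ∃ τ' ∈ intertwiningRibbon ρ ρ' ξ m', τ'.edge = τ.edge) →
        (∀ τ ∈ l, τ.edge ∉ edgesIn (Metric.ball a R)) → crossings l e = 0 := by
      intro l m' hm' h1 h2
      refine crossings_apply_eq_zero fun τ hτ heq => hcon ?_
      rw [← heq]
      obtain ⟨τ', h3, h4⟩ := h1 τ hτ
      refine ⟨?_, h2 τ hτ⟩
      rw [← h4]; exact hσΛ m' hm' τ' h3
    have hmem : ∀ (m' : ℕ) (τ : Triangle), τ ∈ middleRibbon ρ ρ' ξ K m' → K ≤ m' →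
        τ ∈ intertwiningRibbon ρ ρ' ξ m' := by
      intro m' τ hτ hm'
      rw [intertwiningRibbon_eq ρ ρ' ξ hm']; simp [hτ]
    have z1 : crossings (ρ.segment N m) e = 0 := by
      refine hlist _ m (by omega) (fun τ hτ => ⟨τ, hmem m τ ?_ (by omega), rfl⟩) fun τ hτ => ?_
      · rw [middleRibbon, ρ.segment_append hKN hm]; simp [hτ]
      · obtain ⟨k, hk, _, rfl⟩ := HalfInfiniteRibbon.mem_segment hτ
        exact hN₁ k (by omega)
    have z2 : crossings (oppRibbon (ρ'.segment N m)) e = 0 := by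
      refine hlist _ m (by omega) (fun τ hτ => ⟨τ, hmem m τ ?_ (by omega), rfl⟩) fun τ hτ => ?_
      · rw [middleRibbon, ρ'.segment_append hKN hm, oppRibbon_append]; simp [hτ]
      · obtain ⟨τ', h1, h2⟩ := mem_oppRibbon hτ
        obtain ⟨k, hk, _, rfl⟩ := HalfInfiniteRibbon.mem_segment h1
        rw [← h2]
        exact hN₂ k (by omega)
    have z3 : ∀ m' ≥ N, crossings (ξ m') e = 0 := fun m' hm' => by
      refine hlist _ m' (by omega) (fun τ hτ => ⟨τ, hmem m' τ ?_ (by omega), rfl⟩) fun τ hτ => ?_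
      · rw [middleRibbon]; simp [hτ]
      · exact hN₃ m' (by omega) τ hτ
    rw [middleRibbon, middleRibbon, ρ.segment_append hKN hm, ρ'.segment_append hKN hm,
      oppRibbon_append]
    simp [crossings_append, z1, z2, z3 m hm, z3 N le_rfl]
  refine ribbonOp_apply_ground_vector_eq hω₀ hGNS (isRibbon_middleRibbon hξ (by omega)).2
    (isRibbon_middleRibbon hξ (by omega)).2 hp hp' hw hM ?_ ?_ h g
  · exact hR₁ w M hM fun e he => ⟨(hfar e he).1, fun hb =>
      (hfar e he).2 (Metric.ball_subset_ball (le_max_left _ _) hb)⟩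
  · exact hR₂ w M hM fun e he => ⟨(hfar e he).1, fun hb =>
      (hfar e he).2 (Metric.ball_subset_ball (le_max_right _ _) hb)⟩

/-! ### Strong convergence of the intertwining multiplets -/

variable {n : ℕ} (D : QuantumDouble G →⋆ₐ[ℂ] Matrix (Fin n) (Fin n) ℂ)

theorem escapes_finset {ρ ρ' : HalfInfiniteRibbon} {ξ : ℕ → List Triangle}
    (hξ : IsBridge ρ ρ' ξ) (E : Finset Edge) : ∃ N, ∀ m ≥ N, ∀ τ ∈ ξ m, τ.edge ∉ E := by
  obtain ⟨r, hr⟩ := ((E.finite_toSet.image Edge.mid).isBounded).subset_ball (0 : Plane)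
  obtain ⟨N, hN⟩ := eventually_atTop.1 (hξ.escapes 0 r)
  exact ⟨N, fun m hm τ hτ hE => hN m hm τ hτ (hr ⟨τ.edge, hE, rfl⟩)⟩

theorem intertwiningMultiplet_eventually_const (hω₀ : IsFrustrationFreeGroundState ω₀)
    (hGNS : IsGNSTriple ω₀ π₀ Ω) {Λ : Set Plane} (hΛ : IsCone Λ) {ρ ρ' : HalfInfiniteRibbon}
    {ξ : ℕ → List Triangle} (hξ : IsBridge ρ ρ' ξ)
    (hσΛ : ∀ m, 1 ≤ m → RibbonIn (intertwiningRibbon ρ ρ' ξ m) Λ) {O : quasiLocal G}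
    (hO : O ∈ localObs G) (i j : Fin n) :
    ∃ (N : ℕ) (φ : H), ∀ m ≥ N,
      π₀ (ribbonMultiplet D (intertwiningRibbon ρ ρ' ξ m) i j) (π₀ O Ω) = φ := by
  obtain ⟨E, hE⟩ := hO
  obtain ⟨K₁, hK₁⟩ := ρ.eventually_edge_notMem E.finite_toSet
  obtain ⟨K₂, hK₂⟩ := ρ'.eventually_edge_notMem E.finite_toSet
  obtain ⟨K₃, hK₃⟩ := escapes_finset hξ E
  set K := max K₁ K₂ with hK
  obtain ⟨N, hKN, hN⟩ := middleRibbon_apply_ground_vector hω₀ hGNS hΛ hξ hσΛ K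
  have hmult : ∀ m ≥ N, ∀ p q, π₀ (ribbonMultiplet D (middleRibbon ρ ρ' ξ K m) p q) Ω
      = π₀ (ribbonMultiplet D (middleRibbon ρ ρ' ξ K N) p q) Ω := by
    intro m hm p q
    simp only [ribbonMultiplet, Matrix.of_apply, map_sum, map_smul, sum_apply, smul_apply,
      hN m hm]
  -- The limit vector arises by moving the middle part to the right, past the reversed initial part
  -- of `ρ'` and past `O`, until it acts on `Ω`, where it no longer depends on `m`.
  refine ⟨max N K₃, ∑ p, ∑ q, π₀ (ribbonMultiplet D (ρ.initial K) i p *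
    (ribbonMultiplet D (oppRibbon (ρ'.initial K)) q j * O))
      (π₀ (ribbonMultiplet D (middleRibbon ρ ρ' ξ K N) p q) Ω), fun m hm => ?_⟩
  have hrib := hξ.concat m (by omega)
  rw [intertwiningRibbon_eq ρ ρ' ξ (show K ≤ m by omega)] at hrib ⊢
  rw [ribbonMultiplet_append, ribbonMultiplet_append, Matrix.mul_apply]
  simp only [Matrix.mul_apply, Finset.sum_mul]
  rw [← mul_apply_eq_comp, ← map_mul, Finset.sum_mul, map_sum, sum_apply]
  simp only [Finset.sum_mul, map_sum, sum_apply]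
  rw [Finset.sum_comm]
  refine Finset.sum_congr rfl fun p _ => Finset.sum_congr rfl fun q _ => ?_
  -- Distinct parts of a ribbon have disjoint sets of edges, so their operators commute.
  have hcB : ∀ τ ∈ middleRibbon ρ ρ' ξ K m, ∀ g h : G,
      Commute (ribbonMultiplet D (oppRibbon (ρ'.initial K)) q j) (matUnit τ.edge g h) := by
    intro τ hτ g h
    refine (commute_ribbonMultiplet D (fun τ' hτ' g' h' => ?_) q j).symm
    refine commute_matUnit (fun heq => ?_) g h g' h'
    have hnd := hrib.2
    rw [List.map_append, List.nodup_append] at hnd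
    exact hnd.2.2 τ.edge (List.mem_map_of_mem (by simp [hτ])) τ'.edge (List.mem_map_of_mem hτ') heq
  have hcO : ∀ τ ∈ middleRibbon ρ ρ' ξ K m, ∀ g h : G, Commute O (matUnit τ.edge g h) := by
    intro τ hτ g h
    refine hE _ ?_ g h
    simp only [middleRibbon, List.mem_append] at hτ
    rcases hτ with (hτ | hτ) | hτ
    · obtain ⟨k, hk, _, rfl⟩ := HalfInfiniteRibbon.mem_segment hτ
      exact hK₁ k (by omega)
    · exact hK₃ m (by omega) τ hτ
    · obtain ⟨τ', h1, h2⟩ := mem_oppRibbon hτ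
      obtain ⟨k, hk, _, rfl⟩ := HalfInfiniteRibbon.mem_segment h1
      rw [← h2]; exact hK₂ k (by omega)
  have hc : Commute (ribbonMultiplet D (oppRibbon (ρ'.initial K)) q j * O)
      (ribbonMultiplet D (middleRibbon ρ ρ' ξ K m) p q) :=
    (commute_ribbonMultiplet D hcB p q).mul_left (commute_ribbonMultiplet D hcO p q)
  rw [← hmult m (by omega), ← mul_apply_eq_comp, ← map_mul, mul_assoc, mul_assoc, mul_assoc,
    hc.eq]

theorem norm_rep_ribbonMultiplet_le (ρ : List Triangle) (i j : Fin n) :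
    ‖π₀ (ribbonMultiplet D ρ i j)‖ ≤ 1 :=
  (norm_map_le π₀ _).trans (norm_ribbonMultiplet_le D ρ i j)

/-- The multiplets of the intertwining ribbons converge in the strong operator topology. -/
theorem exists_tendsto_intertwiningMultiplet (hω₀ : IsFrustrationFreeGroundState ω₀)
    (hGNS : IsGNSTriple ω₀ π₀ Ω) {Λ : Set Plane} (hΛ : IsCone Λ) {ρ ρ' : HalfInfiniteRibbon}
    {ξ : ℕ → List Triangle} (hξ : IsBridge ρ ρ' ξ)
    (hσΛ : ∀ m, 1 ≤ m → RibbonIn (intertwiningRibbon ρ ρ' ξ m) Λ) :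
    ∃ V : Matrix (Fin n) (Fin n) (H →L[ℂ] H), ∀ i j (ψ : H), Tendsto
      (fun m => π₀ (ribbonMultiplet D (intertwiningRibbon ρ ρ' ξ m) i j) ψ) atTop
      (𝓝 (V i j ψ)) := by
  have hcont : Continuous fun a => π₀ a Ω :=
    (ContinuousLinearMap.apply ℂ H Ω).continuous.comp (continuous_rep π₀)
  have hdense : Dense ((fun a => π₀ a Ω) '' (localObs G : Set (quasiLocal G))) :=
    DenseRange.dense_image hGNS.cyclic hcont dense_localObs
  have hcauchy : ∀ i j (ψ : H), CauchySeq fun m =>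
      π₀ (ribbonMultiplet D (intertwiningRibbon ρ ρ' ξ m) i j) ψ := by
    intro i j ψ
    refine cauchySeq_of_dense (C := 1) (fun m x y => ?_) hdense ?_ ψ
    · rw [← map_sub]
      refine ((π₀ (ribbonMultiplet D (intertwiningRibbon ρ ρ' ξ m) i j)).le_opNorm _).trans ?_
      exact mul_le_mul_of_nonneg_right (norm_rep_ribbonMultiplet_le D _ i j) (norm_nonneg _)
    · rintro _ ⟨O, hO, rfl⟩
      obtain ⟨N, φ, hN⟩ := intertwiningMultiplet_eventually_const D hω₀ hGNS hΛ hξ hσΛ hO i j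
      exact (tendsto_atTop_of_eventually_const (i₀ := N) hN).cauchySeq
  choose L hL using fun i j ψ => cauchySeq_tendsto_of_complete (hcauchy i j ψ)
  exact ⟨Matrix.of fun i j => continuousLinearMapOfTendsto
    (fun m => π₀ (ribbonMultiplet D (intertwiningRibbon ρ ρ' ξ m) i j))
    (tendsto_pi_nhds.2 (hL i j)), fun i j ψ => hL i j ψ⟩

/-- Joint continuity of operator application on norm-bounded sets; it lets products of strong limits
be computed termwise. -/
theorem tendsto_apply_of_norm_le_one {T : ℕ → H →L[ℂ] H} {T' : H →L[ℂ] H} (hT : ∀ m, ‖T m‖ ≤ 1)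
    (h : ∀ ψ, Tendsto (fun m => T m ψ) atTop (𝓝 (T' ψ))) {x : ℕ → H} {y : H}
    (hx : Tendsto x atTop (𝓝 y)) : Tendsto (fun m => T m (x m)) atTop (𝓝 (T' y)) := by
  have h1 : Tendsto (fun m => T m (x m - y)) atTop (𝓝 0) := by
    refine squeeze_zero_norm (fun m => ?_) (tendsto_iff_norm_sub_tendsto_zero.1 hx)
    refine ((T m).le_opNorm _).trans ?_
    exact mul_le_of_le_one_left (norm_nonneg _) (hT m)
  have h2 := h1.add (h y)
  simp only [map_sub, sub_add_cancel, zero_add] at h2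
  exact h2

theorem norm_ampli_sub_le (ρ : HalfInfiniteRibbon) (O O' : quasiLocal G) (i j : Fin n) :
    ‖ampli D ρ O i j - ampli D ρ O' i j‖ ≤ n * ‖O - O'‖ := by
  have h1 := tendsto_pi_nhds.1 (tendsto_pi_nhds.1 (tendsto_finiteAmpli D ρ O) i) j
  have h2 := tendsto_pi_nhds.1 (tendsto_pi_nhds.1 (tendsto_finiteAmpli D ρ O') i) j
  exact le_of_tendsto (h1.sub h2).norm
    (Eventually.of_forall fun m => norm_finiteAmpli_sub_le D (ρ.initial m) O O' i j)

theorem continuous_ampli_apply (ρ : HalfInfiniteRibbon) (i j : Fin n) :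
    Continuous fun O : quasiLocal G => ampli D ρ O i j := by
  have : LipschitzWith n fun O : quasiLocal G => ampli D ρ O i j :=
    LipschitzWith.of_dist_le_mul fun O O' => by
      rw [dist_eq_norm, dist_eq_norm]
      simpa using norm_ampli_sub_le D ρ O O' i j
  exact this.continuous

theorem ampli_eventually_eq (ρ : HalfInfiniteRibbon) {O : quasiLocal G} (hO : O ∈ localObs G) :
    ∃ K, ∀ m ≥ K, finiteAmpli D (ρ.initial m) O = ampli D ρ O := by
  obtain ⟨K, hK⟩ := finiteAmpli_eventually_const D ρ hO
  have h : ampli D ρ O = finiteAmpli D (ρ.initial K) O :=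
    tendsto_nhds_unique (tendsto_finiteAmpli D ρ O)
      (tendsto_atTop_of_eventually_const (i₀ := K) hK)
  exact ⟨K, fun m hm => by rw [hK m hm, h]⟩

/-- Writing the multiplet of the reversed ribbon as `F(ρ') F(ξ̄) F(ρ)*`, the factor `F(ρ)*` cancels
against `F(ρ)`, `O` passes through `F(ξ̄)`, and `F(ρ')* F(ρ') = 1` is inserted. -/
theorem oppMultiplet_mul_finiteAmpli {ρ ξ ρ' : List Triangle} {O : quasiLocal G}
    (hO : ∀ τ ∈ ξ, ∀ g h, Commute O (matUnit τ.edge g h)) :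
    ribbonMultiplet D (oppRibbon (ρ ++ ξ ++ oppRibbon ρ')) * finiteAmpli D ρ O =
      finiteAmpli D ρ' O * ribbonMultiplet D (oppRibbon (ρ ++ ξ ++ oppRibbon ρ')) := by
  have hO' : ∀ τ ∈ oppRibbon ξ, ∀ g h, Commute O (matUnit τ.edge g h) := by
    intro τ hτ g h
    obtain ⟨τ', h1, h2⟩ := mem_oppRibbon hτ
    rw [← h2]; exact hO τ' h1 g h
  have hc := (commute_diagonal_ribbonMultiplet D hO').eq
  have h1 : (ribbonMultiplet D ρ)ᴴ * ribbonMultiplet D ρ = 1 := (ribbonMultiplet_mem_unitary D ρ).1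
  have h2 : (ribbonMultiplet D ρ')ᴴ * ribbonMultiplet D ρ' = 1 :=
    (ribbonMultiplet_mem_unitary D ρ').1
  simp only [oppRibbon_append, oppRibbon_oppRibbon, ribbonMultiplet_append, finiteAmpli,
    ribbonMultiplet_oppRibbon D ρ]
  calc _ = ribbonMultiplet D ρ' * (ribbonMultiplet D (oppRibbon ξ) *
        (((ribbonMultiplet D ρ)ᴴ * ribbonMultiplet D ρ) * (Matrix.diagonal fun _ => O)) *
          (ribbonMultiplet D ρ)ᴴ) := by simp only [mul_assoc]
    _ = ribbonMultiplet D ρ' * ((Matrix.diagonal fun _ => O) *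
        (((ribbonMultiplet D ρ')ᴴ * ribbonMultiplet D ρ') * ribbonMultiplet D (oppRibbon ξ)) *
          (ribbonMultiplet D ρ)ᴴ) := by rw [h1, h2, one_mul, one_mul, hc]
    _ = _ := by simp only [mul_assoc]

end Bridges

/-! ### The intertwiner -/

theorem lemma5p5 {G : Type*} [Group G] [Fintype G] [DecidableEq G]
    (ω₀ : quasiLocal G →ₗ[ℂ] ℂ) (hω₀ : IsFrustrationFreeGroundState ω₀)
    {H : Type*} [NormedAddCommGroup H] [InnerProductSpace ℂ H] [CompleteSpace H]
    (π₀ : quasiLocal G →⋆ₐ[ℂ] (H →L[ℂ] H)) (Ω : H) (hGNS : IsGNSTriple ω₀ π₀ Ω)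
    (Λ : Set Plane) (hΛ : IsCone Λ)
    (ρ ρ' : HalfInfiniteRibbon) (hρ : ρ.IsPositive) (hρ' : ρ'.IsNegative)
    (hρΛ : ρ.SupportedIn Λ) (hρ'Λ : ρ'.SupportedIn Λ)
    (ξ : ℕ → List Triangle) (hξ : IsBridge ρ ρ' ξ)
    (hσΛ : ∀ m, 1 ≤ m → RibbonIn (intertwiningRibbon ρ ρ' ξ m) Λ)
    (n : ℕ) (D : QuantumDouble G →⋆ₐ[ℂ] Matrix (Fin n) (Fin n) ℂ) :
    -- the limits defining the two amplimorphisms exist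
    (∀ O, Tendsto (fun m => finiteAmpli D (ρ.initial m) O) atTop (𝓝 (ampli D ρ O))) ∧
    (∀ O, Tendsto (fun m => finiteAmpli D (ρ'.initial m) O) atTop (𝓝 (ampli D ρ' O))) ∧
    ∃ U : Matrix (Fin n) (Fin n) (H →L[ℂ] H),
      U ∈ unitary (Matrix (Fin n) (Fin n) (H →L[ℂ] H)) ∧
      (∀ i j, U i j ∈ coneAlgebra π₀ Λ) ∧
      (∀ O, (ampli D ρ' O).map π₀ = U * (ampli D ρ O).map π₀ * Uᴴ) ∧
      -- `U` is the strong-* limit of the multiplets of the opposite intertwining ribbons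
      (∀ i j (ψ : H),
        Tendsto (fun m =>
          π₀ (ribbonMultiplet D (oppRibbon (intertwiningRibbon ρ ρ' ξ m)) i j) ψ)
          atTop (𝓝 (U i j ψ)) ∧
        Tendsto (fun m =>
          star (π₀ (ribbonMultiplet D (oppRibbon (intertwiningRibbon ρ ρ' ξ m)) i j)) ψ)
          atTop (𝓝 (star (U i j) ψ))) := by
  -- `W` is the limit along `σ_m` and `U` the limit along the reversed ribbons. The approximants are
  -- mutually adjoint, so strong-* convergence to `U` amounts to these two strong limits together
  -- with `Uᴴ = W`.
  obtain ⟨W, hW⟩ := exists_tendsto_intertwiningMultiplet D hω₀ hGNS hΛ hξ hσΛ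
  obtain ⟨U, hU⟩ := exists_tendsto_intertwiningMultiplet D hω₀ hGNS hΛ hξ.symm fun m hm => by
    rw [← oppRibbon_intertwiningRibbon]; exact (hσΛ m hm).oppRibbon
  simp only [← oppRibbon_intertwiningRibbon] at hU
  have hstarV : ∀ m i j, star (π₀ (ribbonMultiplet D (oppRibbon (intertwiningRibbon ρ ρ' ξ m)) i j))
      = π₀ (ribbonMultiplet D (intertwiningRibbon ρ ρ' ξ m) j i) := by
    intro m i j
    rw [← map_star, ribbonMultiplet_oppRibbon, Matrix.conjTranspose_apply, star_star]
  have hstar : ∀ i j, star (U i j) = W j i := by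
    intro i j
    rw [ContinuousLinearMap.star_eq_adjoint, eq_comm, ContinuousLinearMap.eq_adjoint_iff]
    intro x y
    have h1 := ((hW j i x).inner (𝕜 := ℂ) (tendsto_const_nhds (x := y)))
    have h2 := ((tendsto_const_nhds (x := x)).inner (𝕜 := ℂ) (hU i j y))
    refine tendsto_nhds_unique h1 (h2.congr fun m => ?_)
    rw [← hstarV, ContinuousLinearMap.star_eq_adjoint, ContinuousLinearMap.adjoint_inner_left]
  have hUH : Uᴴ = W := by
    ext i j : 1
    rw [Matrix.conjTranspose_apply, hstar]
  have hprod : ∀ (A B : ℕ → Matrix (Fin n) (Fin n) (quasiLocal G))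
      (A' B' : Matrix (Fin n) (Fin n) (H →L[ℂ] H)), (∀ m i j, ‖π₀ (A m i j)‖ ≤ 1) →
      (∀ i j ψ, Tendsto (fun m => π₀ (A m i j) ψ) atTop (𝓝 (A' i j ψ))) →
      (∀ i j ψ, Tendsto (fun m => π₀ (B m i j) ψ) atTop (𝓝 (B' i j ψ))) →
      (∀ m, A m * B m = 1) → A' * B' = 1 := by
    intro A B A' B' hA hA' hB' hAB
    ext i j ψ
    have h1 : Tendsto (fun m => ∑ k, π₀ (A m i k) (π₀ (B m k j) ψ)) atTop
        (𝓝 ((A' * B') i j ψ)) := by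
      rw [Matrix.mul_apply, sum_apply]
      exact tendsto_finsetSum _ fun k _ =>
        tendsto_apply_of_norm_le_one (fun m => hA m i k) (hA' i k) (hB' k j ψ)
    refine tendsto_nhds_unique h1 ?_
    have h2 : ∀ m, ∑ k, π₀ (A m i k) (π₀ (B m k j) ψ)
        = (1 : Matrix (Fin n) (Fin n) (H →L[ℂ] H)) i j ψ := by
      intro m
      have h3 := congrFun (congrFun (hAB m) i) j
      rw [Matrix.mul_apply] at h3
      have h4 := congrArg (fun a => π₀ a ψ) h3
      simp only [map_sum, map_mul, sum_apply, mul_apply_eq_comp] at h4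
      rw [h4, Matrix.one_apply, Matrix.one_apply]
      split_ifs <;> simp
    simp only [h2]
    exact tendsto_const_nhds
  have hUW : U * W = 1 := hprod _ _ U W (fun m i j => norm_rep_ribbonMultiplet_le D _ i j) hU hW
    fun m => by
      rw [ribbonMultiplet_oppRibbon]
      exact (ribbonMultiplet_mem_unitary D (intertwiningRibbon ρ ρ' ξ m)).1
  have hWU : W * U = 1 := hprod _ _ W U (fun m i j => norm_rep_ribbonMultiplet_le D _ i j) hW hU
    fun m => by
      rw [ribbonMultiplet_oppRibbon]
      exact (ribbonMultiplet_mem_unitary D (intertwiningRibbon ρ ρ' ξ m)).2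
  refine ⟨tendsto_finiteAmpli D ρ, tendsto_finiteAmpli D ρ', U, ⟨?_, ?_⟩, ?_, ?_, ?_⟩
  · rw [Matrix.star_eq_conjTranspose, hUH, hWU]
  · rw [Matrix.star_eq_conjTranspose, hUH, hUW]
  · intro i j
    rw [coneAlgebra, Set.mem_centralizer_iff]
    -- `T` lies in the commutant of `π₀(𝒜_Λ)`. It commutes with each approximant, whose ribbon is
    -- supported in `Λ`, and therefore with the strong limit.
    intro T hT
    ext ψ
    have h1 := (T.continuous.tendsto _).comp (hU i j ψ)
    refine tendsto_nhds_unique h1 ((hU i j (T ψ)).congr' ?_)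
    filter_upwards [eventually_ge_atTop 1] with m hm
    have h2 := (Set.mem_centralizer_iff.1 hT)
      (π₀ (ribbonMultiplet D (oppRibbon (intertwiningRibbon ρ ρ' ξ m)) i j))
      ⟨_, ribbonMultiplet_mem_localAlgebra D (hσΛ m hm).oppRibbon i j, rfl⟩
    exact congrArg (fun S : H →L[ℂ] H => S ψ) h2
  · intro O
    suffices h : (ampli D ρ' O).map π₀ * U = U * (ampli D ρ O).map π₀ by
      rw [← h, mul_assoc, hUH, hUW, mul_one]
    ext i j : 1
    simp only [Matrix.mul_apply, Matrix.map_apply]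
    have hc1 : Continuous fun O => ∑ k, π₀ (ampli D ρ' O i k) * U k j :=
      continuous_finsetSum _ fun k _ =>
        ((continuous_rep π₀).comp (continuous_ampli_apply D ρ' i k)).mul continuous_const
    have hc2 : Continuous fun O => ∑ k, U i k * π₀ (ampli D ρ O k j) :=
      continuous_finsetSum _ fun k _ =>
        continuous_const.mul ((continuous_rep π₀).comp (continuous_ampli_apply D ρ k j))
    -- Both sides are norm continuous in `O`, so local observables suffice. For these the two
    -- amplimorphisms have stabilised and the bridge has left the support at large `m`, so the
    -- finite intertwining relation is exact before the limit is taken.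
    refine congrFun (hc1.ext_on dense_localObs hc2 fun O hO => ?_) O
    obtain ⟨K₁, hK₁⟩ := ampli_eventually_eq D ρ hO
    obtain ⟨K₂, hK₂⟩ := ampli_eventually_eq D ρ' hO
    obtain ⟨E, hE⟩ := hO
    obtain ⟨K₃, hK₃⟩ := escapes_finset hξ E
    ext ψ
    simp only [sum_apply, mul_apply_eq_comp]
    have h1 := tendsto_finsetSum (Finset.univ : Finset (Fin n)) fun k _ =>
      ((π₀ (ampli D ρ' O i k)).continuous.tendsto _).comp (hU k j ψ)
    have h2 := tendsto_finsetSum (Finset.univ : Finset (Fin n)) fun k _ =>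
      hU i k (π₀ (ampli D ρ O k j) ψ)
    refine tendsto_nhds_unique h1 (h2.congr' ?_)
    filter_upwards [eventually_ge_atTop (max K₁ (max K₂ K₃))] with m hm
    have h3 := oppMultiplet_mul_finiteAmpli D (ρ := ρ.initial m) (ξ := ξ m) (ρ' := ρ'.initial m)
      (O := O) fun τ hτ => hE _ (hK₃ m (by omega) τ hτ)
    rw [hK₁ m (by omega), hK₂ m (by omega)] at h3
    have h4 := congrFun (congrFun h3 i) j
    simp only [Matrix.mul_apply] at h4
    have h5 := congrArg (fun a => π₀ a ψ) h4
    simp only [map_sum, map_mul, sum_apply, mul_apply_eq_comp] at h5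
    exact h5
  · intro i j ψ
    refine ⟨hU i j ψ, ?_⟩
    simp only [hstarV, hstar]
    exact hW j i ψ
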